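/- Let $\rho_0\in(0,1)$ and $\lambda_1>0$. There is a number $T_0=T_0(\rho_0,\lambda_1)>0$, depending only on $\rho_0$ and $\lambda_1$, such that the following holds. Let $H$ be a separable (real or complex) Hilbert space and let $A$ be a (possibly unbounded) self-adjoint operator in $H$ with a complete orthonormal system of eigenvectors $v_k$, $Av_k=\lambda_kv_k$, whose smallest eigenvalue is $\lambda_1$ (so $A$ is positive). Let $\varphi\in H$, $\varphi\neq0$, and $T_0\le t_0\le T$. For $\rho\in(0,1)$ let $\partial_t^{\rho-1}h(t)=\frac1{\Gamma(1-\rho)}\int_0^t(t-\xi)^{-\rho}h(\xi)\,d\xi$ and let $\partial_t^{\rho}h=\frac{d}{dt}\partial_t^{\rho-1}h$ be the Riemann–Liouville derivative; for $\rho=1$ let $\partial_t^{0}h=h$ and $\partial_t^1h=\frac{d}{dt}h$. A solution of the forward problem of order $\rho\in(0,1]$ is a function $u:(0,T]\to H$ such that $\partial_t^\rho u$ and $Au$ exist and are continuous on $(0,T]$, $\partial_t^\rho u(t)+Au(t)=0$ for $0<t\le T$, and $\lim_{t\to0+}\partial_t^{\rho-1}u(t)=\varphi$. Then for each $\rho\in[\rho_0,1]$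 the forward problem of order $\rho$ has a unique solution $u_\rho$; put $W(t_0,\rho)=\|u_\rho(t_0)\|^2$. Moreover, for every $d_0\in\mathbb R$, there is exactly one pair $\{u,\rho\}$ such that $\rho\in[\rho_0,1]$, $u$ is a solution of the forward problem of order $\rho$, and $\|u(t_0)\|^2=d_0$, if and only if $$W(t_0,1)\le d_0\le W(t_0,\rho_0).$$ -/

import Mathlib

open Set Filter Topology MeasureTheory

noncomputable section

namespace Subdiffusion

variable {𝕜 : Type*} [RCLike 𝕜]
  {H : Type*} [NormedAddCommGroup H] [InnerProductSpace 𝕜 H] [NormedSpace ℝ H]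

/-- The Riemann–Liouville fractional integral of order `α ≥ 0` (that is, `∂_t^{-α} h`),
`(1 / Γ(α)) ∫_0^t (t - ξ)^{α - 1} h(ξ) dξ`, a Bochner integral in `H`.
The integral of order `0` is the identity. -/
def rlIntegral {H : Type*} [NormedAddCommGroup H] [NormedSpace ℝ H]
    (α : ℝ) (h : ℝ → H) (t : ℝ) : H :=
  if α = 0 then h t
  else (1 / Real.Gamma α) • ∫ ξ in (0 : ℝ)..t, (t - ξ) ^ (α - 1) • h ξ

/-- The fractional integral of order `α` of `h` exists at the time `t`. -/
def RLIntegrable {H : Type*} [NormedAddCommGroup H] [NormedSpace ℝ H]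
    (α : ℝ) (h : ℝ → H) (t : ℝ) : Prop :=
  α = 0 ∨ IntervalIntegrable (fun ξ => (t - ξ) ^ (α - 1) • h ξ) volume 0 t

/-- On `(0, T]` the function `h` has the Riemann–Liouville derivative
`∂_t^ρ h = d/dt (∂_t^{ρ-1} h) = D`, for `0 < ρ ≤ 1` (strong derivative; from the left at `T`).
For `ρ = 1` this is the ordinary derivative. -/
def HasRLDerivOn {H : Type*} [NormedAddCommGroup H] [NormedSpace ℝ H]
    (ρ T : ℝ) (h D : ℝ → H) : Prop :=
  ∀ t ∈ Ioc (0 : ℝ) T, RLIntegrable (1 - ρ) h t ∧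
    HasDerivWithinAt (rlIntegral (1 - ρ) h) (D t) (Ioc 0 T) t

/-- `u` solves the forward problem of order `ρ` on `(0, T]`:
`∂_t^ρ u` and `A u` exist and are continuous on `(0, T]`, `∂_t^ρ u + A u = 0` there, and
`∂_t^{ρ-1} u(t) → φ` as `t → 0+` (for `ρ = 1`: `u(t) → φ`).
Only the values of `u` on `(0, T]` matter. -/
def IsForwardSolution (A : H →ₗ.[𝕜] H) (φ : H) (T ρ : ℝ) (u : ℝ → H) : Prop :=
  ∃ D Au : ℝ → H,
    HasRLDerivOn ρ T u D ∧
    (∀ t ∈ Ioc (0 : ℝ) T, (u t, Au t) ∈ A.graph) ∧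
    ContinuousOn D (Ioc 0 T) ∧ ContinuousOn Au (Ioc 0 T) ∧
    (∀ t ∈ Ioc (0 : ℝ) T, D t + Au t = 0) ∧
    Tendsto (rlIntegral (1 - ρ) u) (𝓝[>] 0) (𝓝 φ)

/-- The forward problem of order `ρ` on `(0, T]` has exactly one solution
(as a function on `(0, T]`). -/
def ForwardWellPosed (A : H →ₗ.[𝕜] H) (φ : H) (T ρ : ℝ) : Prop :=
  ∃ u : ℝ → H, IsForwardSolution A φ T ρ u ∧
    ∀ u' : ℝ → H, IsForwardSolution A φ T ρ u' → EqOn u' u (Ioc 0 T)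

/-- `W(t, ρ) = ‖u(t)‖²`, where `u` is the solution of the forward problem of order `ρ`. -/
def W (A : H →ₗ.[𝕜] H) (φ : H) (T t ρ : ℝ) : ℝ :=
  ‖Classical.epsilon (fun u : ℝ → H => IsForwardSolution A φ T ρ u) t‖ ^ 2

/-- The pair `{u, ρ}` solves the inverse problem: `ρ ∈ [ρ₀, 1]`, `u` solves the forward problem
of order `ρ`, and `‖u(t₀)‖² = d₀`. -/
def IsInverseSolution (A : H →ₗ.[𝕜] H) (φ : H) (T ρ₀ t₀ d₀ : ℝ) (u : ℝ → H) (ρ : ℝ) : Prop :=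
  ρ ∈ Icc ρ₀ 1 ∧ IsForwardSolution A φ T ρ u ∧ ‖u t₀‖ ^ 2 = d₀

/-- The inverse problem has exactly one solution `{u, ρ}`
(`u` being regarded as a function on `(0, T]`). -/
def HasUniqueInverseSolution (A : H →ₗ.[𝕜] H) (φ : H) (T ρ₀ t₀ d₀ : ℝ) : Prop :=
  ∃ (u : ℝ → H) (ρ : ℝ), IsInverseSolution A φ T ρ₀ t₀ d₀ u ρ ∧
    ∀ (u' : ℝ → H) (ρ' : ℝ), IsInverseSolution A φ T ρ₀ t₀ d₀ u' ρ' →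
      ρ' = ρ ∧ EqOn u' u (Ioc 0 T)

end Subdiffusion

end

noncomputable section

namespace Subdiffusion

/-! ### Integrals of double exponentials along horizontal lines -/

/-! Expanding in the eigenbasis, the solution of order `ρ` has coefficients `scalarSol ρ λ_k t *
⟨v_k, φ⟩`, where `scalarSol ρ λ t = t^(ρ-1) E_{ρ,ρ}(-λ t^ρ)`. By Parseval, `W(t, ρ)` is the sum of
`scalarSol ρ λ_k t ^ 2 * ‖⟨v_k, φ⟩‖ ^ 2`. If every `scalarSol · λ t₀` with `λ ≥ λ₁` is positive,
continuous and strictly decreasing on `[ρ₀, 1]`, then so is `W(t₀, ·)`, since `φ ≠ 0`. The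
intermediate value theorem and injectivity then give the criterion.

The analytic core is this monotonicity, with a threshold `T₀` uniform in `λ ≥ λ₁`
(`exists_strictAntiOn_scalarSol`). Hankel's formula for `1/Γ`, summed against a geometric series,
gives a contour integral for `E_{ρ,ρ}(-μ)`. Its integrand has no pole between the rays of argument
`±2π/3`, so the arc shrinks to the origin and one real integral remains (`pi_mul_ml`). Expanding
`1/(q+λ)` to second order in `q = (z/t)^ρ` shows that `π λ² t * scalarSol` equals `sin(πρ) Γ(1+ρ)
t^(-ρ)` plus a remainder of order `t^(-2ρ)`; the term of order `1/λ` has zero imaginary part. The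
`ρ`-derivative of the leading term is at most `-c t^(-ρ)`: away from `ρ = 1` the factor `-log t`
wins, and near `ρ = 1`, where the sine vanishes, `cos(πρ)` is negative. The derivative of the
remainder is `O((1 + log t) t^(-2ρ) / λ)`, hence negligible for large `t`. Positivity follows
because the value at `ρ = 1` is `exp(-λt)`.

For the forward problem, existence rests on bounds of `scalarSol` and `λ * scalarSol` uniform in `λ`
(`exists_scalarSol_bounds`) and on the integrated scalar equation (`rlIntegral_scalarSol`).
Uniqueness reduces, coefficient by coefficient, to a homogeneous Abel equation, which a weighted
supremum norm shows to have only the zero solution (`eq_zero_of_hasRLDerivOn`). -/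

theorem integrable_exp_mul_exp_neg_exp {b c : ℝ} (hb : 0 < b) (hc : 0 < c) :
    Integrable fun x : ℝ => Real.exp (b * x) * Real.exp (-c * Real.exp x) := by
  have h1 : IntegrableOn (fun r : ℝ => r ^ (b - 1) * Real.exp (-c * r ^ (1 : ℝ))) (Ioi 0) :=
    integrableOn_rpow_mul_exp_neg_mul_rpow (by linarith) one_pos hc
  have himg : Real.exp '' univ = Ioi 0 := by rw [image_univ, Real.range_exp]
  rw [← himg, integrableOn_image_iff_integrableOn_abs_deriv_smul MeasurableSet.univ
    (fun x _ => (Real.hasDerivAt_exp x).hasDerivWithinAt) Real.exp_injective.injOn,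
    integrableOn_univ] at h1
  refine h1.congr (Eventually.of_forall fun x => ?_)
  simp only [smul_eq_mul, abs_of_pos (Real.exp_pos x), Real.rpow_one]
  rw [← mul_assoc, ← Real.exp_mul, ← Real.exp_add]
  congr 2
  ring

/-- Integration over the real line after the substitution `r = exp x`. -/
theorem integral_comp_exp_univ {E : Type*} [NormedAddCommGroup E] [NormedSpace ℝ E]
    (g : ℝ → E) : ∫ r in Ioi (0 : ℝ), g r = ∫ x : ℝ, Real.exp x • g (Real.exp x) := by
  have himg : Real.exp '' univ = Ioi 0 := by rw [image_univ, Real.range_exp]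
  rw [← himg, integral_image_eq_integral_abs_deriv_smul MeasurableSet.univ
    (fun x _ => (Real.hasDerivAt_exp x).hasDerivWithinAt) Real.exp_injective.injOn]
  simp [abs_of_pos (Real.exp_pos _)]

theorem abs_le_two_mul_exp_half (x : ℝ) : |x| ≤ 2 * (Real.exp (x / 2) + Real.exp (-(x / 2))) := by
  have h1 := Real.add_one_le_exp (x / 2)
  have h2 := Real.add_one_le_exp (-(x / 2))
  have h3 := Real.exp_pos (x / 2)
  have h4 := Real.exp_pos (-(x / 2))
  rw [abs_le]
  constructor <;> linarith

/-- The factor `|x|` is absorbed by shifting `b` by `1/2` in both directions, whence the requirement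
`1/2 < b`. Such a factor appears when `z^ρ` is differentiated in `ρ`. -/
theorem integrable_abs_mul_exp_mul_exp_neg_exp {b c : ℝ} (hb : 1 / 2 < b) (hc : 0 < c) :
    Integrable fun x : ℝ => |x| * (Real.exp (b * x) * Real.exp (-c * Real.exp x)) := by
  have h1 := (integrable_exp_mul_exp_neg_exp (b := b + 1 / 2) (by linarith) hc).const_mul 2
  have h2 := (integrable_exp_mul_exp_neg_exp (b := b - 1 / 2) (by linarith) hc).const_mul 2
  refine (h1.add h2).mono' (by fun_prop) (Eventually.of_forall fun x => ?_)
  have hpos : 0 < Real.exp (b * x) * Real.exp (-c * Real.exp x) := by positivity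
  rw [Real.norm_of_nonneg (by positivity)]
  calc _ ≤ 2 * (Real.exp (x / 2) + Real.exp (-(x / 2))) *
        (Real.exp (b * x) * Real.exp (-c * Real.exp x)) := by
        gcongr; exact abs_le_two_mul_exp_half x
    _ = _ := by
      simp only [Pi.add_apply]
      rw [show (b + 1 / 2) * x = x / 2 + b * x by ring,
        show (b - 1 / 2) * x = -(x / 2) + b * x by ring, Real.exp_add, Real.exp_add]
      ring

/-! ### Moving lines and vertical segments -/

theorem tendsto_integral_vertical {g : ℂ → ℂ} {α β : ℝ} {B : ℝ → ℝ} {l : Filter ℝ}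
    (hαβ : α ≤ β) (hB : Tendsto B l (𝓝 0))
    (hg : ∀ᶠ x : ℝ in l, ∀ y : ℝ, y ∈ Icc α β → ‖g (x + y * Complex.I)‖ ≤ B x) :
    Tendsto (fun x : ℝ => ∫ y in α..β, g (x + y * Complex.I)) l (𝓝 0) := by
  refine squeeze_zero_norm' (a := fun x => B x * |β - α|) ?_ (by simpa using hB.mul_const |β - α|)
  filter_upwards [hg] with x hx
  refine intervalIntegral.norm_integral_le_of_norm_le_const fun y hy => hx y ?_
  rw [uIoc_of_le hαβ] at hy
  exact Ioc_subset_Icc_self hy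

theorem integral_rect {g : ℂ → ℂ} {α β : ℝ} (hαβ : α ≤ β)
    (hg : ∀ w : ℂ, w.im ∈ Icc α β → DifferentiableAt ℂ g w) (b a : ℝ) :
    (∫ x in b..a, g (x + α * Complex.I)) - (∫ x in b..a, g (x + β * Complex.I)) +
      Complex.I * (∫ y in α..β, g (a + y * Complex.I)) -
      Complex.I * (∫ y in α..β, g (b + y * Complex.I)) = 0 := by
  have := Complex.integral_boundary_rect_eq_zero_of_differentiableOn g
    (b + α * Complex.I) (a + β * Complex.I) (fun w hw => (hg w ?_).differentiableWithinAt)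
  · simpa using this
  · have h2 := hw.2
    simpa [uIcc_of_le hαβ] using h2

/-- Cauchy's theorem on the rectangle over `[-x, x]`; the vertical sides tend to zero as `x → ∞`. -/
theorem integral_line_eq_of_tendsto {g : ℂ → ℂ} {α β : ℝ} {B : ℝ → ℝ} (hαβ : α ≤ β)
    (hg : ∀ w : ℂ, w.im ∈ Icc α β → DifferentiableAt ℂ g w)
    (hα : Integrable fun x : ℝ => g (x + α * Complex.I))
    (hβ : Integrable fun x : ℝ => g (x + β * Complex.I))
    (hB : ∀ x y : ℝ, y ∈ Icc α β → ‖g (x + y * Complex.I)‖ ≤ B x)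
    (hbot : Tendsto B atBot (𝓝 0)) (htop : Tendsto B atTop (𝓝 0)) :
    ∫ x : ℝ, g (x + α * Complex.I) = ∫ x : ℝ, g (x + β * Complex.I) := by
  have h1 := intervalIntegral_tendsto_integral hα tendsto_neg_atTop_atBot tendsto_id
  have h2 := intervalIntegral_tendsto_integral hβ tendsto_neg_atTop_atBot tendsto_id
  have h3 := (tendsto_integral_vertical hαβ htop (Eventually.of_forall hB)).const_mul Complex.I
  have h4 := ((tendsto_integral_vertical hαβ hbot (Eventually.of_forall hB)).comp
    tendsto_neg_atTop_atBot).const_mul Complex.I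
  have h5 := ((h1.sub h2).add h3).sub h4
  have h6 := tendsto_nhds_unique h5 (tendsto_const_nhds.congr fun x => by
    simpa using (integral_rect hαβ hg (-x) x).symm)
  rw [mul_zero, add_zero, sub_zero] at h6
  exact sub_eq_zero.1 h6

/-- On a line where `cos y < 0` the integrand decays doubly exponentially to the right and like `exp
(b x)` to the left. -/
theorem norm_exp_exp_line (b x y : ℝ) :
    ‖Complex.exp (Complex.exp (x + y * Complex.I) + b * (x + y * Complex.I))‖ =
      Real.exp (b * x) * Real.exp (Real.cos y * Real.exp x) := by
  rw [Complex.norm_exp, ← Real.exp_add]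
  congr 1
  simp [Complex.exp_re]
  ring

theorem tendsto_exp_mul_exp_neg_exp_atTop (b : ℝ) {c : ℝ} (hc : 0 < c) :
    Tendsto (fun x : ℝ => Real.exp (b * x) * Real.exp (-c * Real.exp x)) atTop (𝓝 0) := by
  have := (tendsto_rpow_mul_exp_neg_mul_atTop_nhds_zero b c hc).comp Real.tendsto_exp_atTop
  refine this.congr fun x => ?_
  simp [← Real.exp_mul, mul_comm x b]

theorem tendsto_exp_mul_exp_neg_exp_atBot {b : ℝ} (hb : 0 < b) {c : ℝ} (hc : 0 ≤ c) :
    Tendsto (fun x : ℝ => Real.exp (b * x) * Real.exp (-c * Real.exp x)) atBot (𝓝 0) := by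
  have h : Tendsto (fun x : ℝ => Real.exp (b * x)) atBot (𝓝 0) :=
    Real.tendsto_exp_atBot.comp (tendsto_id.const_mul_atBot hb)
  refine squeeze_zero (fun x => by positivity) (fun x => ?_) h
  refine mul_le_of_le_one_right (by positivity) (Real.exp_le_one_iff.2 ?_)
  have := Real.exp_pos x
  nlinarith

/-- The integral `∫ exp (e ^ w + b w)` along the line `Im w = φ`. -/
theorem integral_exp_exp_line {b φ : ℝ} (hb : 0 < b) (h1 : Real.pi / 2 < φ) (h2 : φ ≤ Real.pi) :
    ∫ x : ℝ, Complex.exp (Complex.exp (x + φ * Complex.I) + b * (x + φ * Complex.I)) =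
      Complex.exp (Real.pi * b * Complex.I) * Real.Gamma b := by
  have hcos : Real.cos φ < 0 :=
    Real.cos_neg_of_pi_div_two_lt_of_lt h1 (by linarith [Real.pi_pos])
  set g : ℂ → ℂ := fun w => Complex.exp (Complex.exp w + b * w) with hg
  have hint : ∀ y : ℝ, Real.cos y < 0 → Integrable fun x : ℝ => g (x + y * Complex.I) := by
    intro y hy
    refine (integrable_exp_mul_exp_neg_exp hb (neg_pos.2 hy)).mono'
      (by simp only [hg]; fun_prop) (Eventually.of_forall fun x => ?_)
    rw [hg, norm_exp_exp_line, neg_neg]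
  -- The line is raised to height `π`, where `exp w` is negative real and the integral becomes
  -- Euler's integral for `Γ(b)`. Cosine decreases on `[φ, π]`, so `cos φ` serves as a common decay
  -- rate.
  have key := integral_line_eq_of_tendsto (g := g) h2 (fun w _ => by simp only [hg]; fun_prop)
    (hint φ hcos) (hint Real.pi (by simp))
    (B := fun x => Real.exp (b * x) * Real.exp (-(-Real.cos φ) * Real.exp x)) (fun x y hy => by
      rw [hg, norm_exp_exp_line, neg_neg]
      have := Real.cos_le_cos_of_nonneg_of_le_pi (by linarith [Real.pi_pos]) hy.2 hy.1
      gcongr) (tendsto_exp_mul_exp_neg_exp_atBot hb (by linarith))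
    (tendsto_exp_mul_exp_neg_exp_atTop b (by linarith))
  rw [hg] at key
  rw [key]
  have h3 := Real.integral_rpow_mul_exp_neg_mul_Ioi hb one_pos
  rw [integral_comp_exp_univ] at h3
  have : ∀ x : ℝ, Complex.exp (Complex.exp (x + Real.pi * Complex.I) +
      b * (x + Real.pi * Complex.I)) = Complex.exp (Real.pi * b * Complex.I) *
      ((Real.exp x • ((Real.exp x) ^ (b - 1) * Real.exp (-(1 * Real.exp x))) : ℝ) : ℂ) := by
    intro x
    rw [← Real.exp_mul, smul_eq_mul, ← Real.exp_add, ← Real.exp_add, Complex.exp_add (x : ℂ),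
      Complex.exp_pi_mul_I, Complex.ofReal_exp, ← Complex.exp_add]
    congr 1
    push_cast
    ring
  simp_rw [this]
  rw [integral_const_mul, integral_complex_ofReal, h3]
  simp

/-! ### Hankel contours in the logarithmic coordinate -/

/-- The opening angle `2π/3` of the Hankel contour. -/
def ang : ℝ := 2 * Real.pi / 3

theorem ang_pos : 0 < ang := by unfold ang; positivity

theorem pi_div_two_lt_ang : Real.pi / 2 < ang := by unfold ang; linarith [Real.pi_pos]

theorem ang_lt_pi : ang < Real.pi := by unfold ang; linarith [Real.pi_pos]

theorem cos_ang : Real.cos ang = -(1 / 2) := by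
  rw [ang, show 2 * Real.pi / 3 = Real.pi - Real.pi / 3 by ring, Real.cos_pi_sub,
    Real.cos_pi_div_three]

/-- The contour integral `∫ G(z) dz / z` over the contour that comes from infinity along the ray of
argument `-2π/3`, follows the arc of radius `exp a`, and leaves along the ray of argument `2π/3`,
for `g w = G (exp w)`. -/
def hankel (a : ℝ) (g : ℂ → ℂ) : ℂ :=
  (∫ x in Ioi a, (g (x + ang * Complex.I) - g (x + (-ang : ℝ) * Complex.I))) +
    Complex.I * ∫ y in (-ang)..ang, g (a + y * Complex.I)

/-- If the vertical segments vanish at `-∞`, the arc of the contour may be shrunk to a point. -/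
theorem hankel_eq_integral_lines {g : ℂ → ℂ} {B : ℝ → ℝ} (a : ℝ)
    (hg : ∀ w : ℂ, w.im ∈ Icc (-ang) ang → DifferentiableAt ℂ g w)
    (hp : Integrable fun x : ℝ => g (x + ang * Complex.I))
    (hm : Integrable fun x : ℝ => g (x + (-ang : ℝ) * Complex.I))
    (hB : ∀ x ≤ a, ∀ y : ℝ, y ∈ Icc (-ang) ang → ‖g (x + y * Complex.I)‖ ≤ B x)
    (hbot : Tendsto B atBot (𝓝 0)) :
    hankel a g =
      (∫ x : ℝ, g (x + ang * Complex.I)) - ∫ x : ℝ, g (x + (-ang : ℝ) * Complex.I) := by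
  have hle : -ang ≤ ang := by linarith [ang_pos]
  have h1 := intervalIntegral_tendsto_integral_Iic a hp.integrableOn tendsto_id
  have h2 := intervalIntegral_tendsto_integral_Iic a hm.integrableOn tendsto_id
  have h3 := (tendsto_integral_vertical (g := g) hle hbot
    (by filter_upwards [eventually_le_atBot a] with x hx using hB x hx)).const_mul Complex.I
  have h5 := ((h2.sub h1).add
    (tendsto_const_nhds (x := Complex.I * ∫ y in (-ang)..ang, g (a + y * Complex.I)))).sub h3
  have h6 := tendsto_nhds_unique h5 (tendsto_const_nhds.congr fun x => by
    simpa using (integral_rect hle hg x a).symm)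
  have h7 := intervalIntegral.integral_Iic_add_Ioi hp.integrableOn (hp.integrableOn (s := Ioi a))
  have h8 := intervalIntegral.integral_Iic_add_Ioi hm.integrableOn (hm.integrableOn (s := Ioi a))
  rw [hankel, integral_sub hp.integrableOn hm.integrableOn, ← h7, ← h8]
  linear_combination h6

/-- Dominated convergence on the rays and on the arc separately. It is used both for a limit in the
parameter of the Gamma kernel and for the partial sums of the Mittag-Leffler series. -/
theorem tendsto_hankel {ι : Type*} {l : Filter ι} [l.IsCountablyGenerated] {G : ι → ℂ → ℂ}
    {g : ℂ → ℂ} {B : ℝ → ℝ} {C a : ℝ} (hG : ∀ᶠ n in l, Continuous (G n))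
    (hp : ∀ᶠ n in l, ∀ x : ℝ, a < x → ‖G n (x + ang * Complex.I)‖ ≤ B x)
    (hm : ∀ᶠ n in l, ∀ x : ℝ, a < x → ‖G n (x + (-ang : ℝ) * Complex.I)‖ ≤ B x)
    (hB : IntegrableOn B (Ioi a))
    (hC : ∀ᶠ n in l, ∀ y : ℝ, y ∈ Icc (-ang) ang → ‖G n (a + y * Complex.I)‖ ≤ C)
    (hlim : ∀ x y : ℝ, a ≤ x → y ∈ Icc (-ang) ang →
      Tendsto (fun n => G n (x + y * Complex.I)) l (𝓝 (g (x + y * Complex.I)))) :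
    Tendsto (fun n => hankel a (G n)) l (𝓝 (hankel a g)) := by
  have hpos := ang_pos
  refine Tendsto.add ?_ (Tendsto.const_mul _ ?_)
  · refine tendsto_integral_filter_of_dominated_convergence (fun x => B x + B x) ?_ ?_
      (hB.add hB) ?_
    · filter_upwards [hG] with n hn
      fun_prop
    · filter_upwards [hp, hm] with n h1 h2
      filter_upwards [ae_restrict_mem measurableSet_Ioi] with x hx
      exact (norm_sub_le _ _).trans (add_le_add (h1 x hx) (h2 x hx))
    · filter_upwards [ae_restrict_mem measurableSet_Ioi] with x hx
      exact (hlim x ang (le_of_lt hx) (by constructor <;> linarith)).sub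
        (hlim x (-ang) (le_of_lt hx) (by constructor <;> linarith))
  · refine intervalIntegral.tendsto_integral_filter_of_dominated_convergence (fun _ => C) ?_ ?_
      (by simp) ?_
    · filter_upwards [hG] with n hn
      fun_prop
    · filter_upwards [hC] with n hn
      refine Eventually.of_forall fun y hy => hn y ?_
      rw [uIoc_of_le (by linarith)] at hy
      exact Ioc_subset_Icc_self hy
    · refine Eventually.of_forall fun y hy => hlim a y le_rfl ?_
      rw [uIoc_of_le (by linarith)] at hy
      exact Ioc_subset_Icc_self hy

/-- Integrability along both rays of the Hankel contour, together with continuity. -/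
structure HankelIntegrable (a : ℝ) (g : ℂ → ℂ) : Prop where
  cont : Continuous g
  upper : IntegrableOn (fun x : ℝ => g (x + ang * Complex.I)) (Ioi a)
  lower : IntegrableOn (fun x : ℝ => g (x + (-ang : ℝ) * Complex.I)) (Ioi a)

theorem HankelIntegrable.add {a : ℝ} {g h : ℂ → ℂ} (hg : HankelIntegrable a g)
    (hh : HankelIntegrable a h) : HankelIntegrable a (fun w => g w + h w) :=
  ⟨hg.cont.add hh.cont, hg.upper.add hh.upper, hg.lower.add hh.lower⟩

theorem HankelIntegrable.const_mul {a : ℝ} {g : ℂ → ℂ} (hg : HankelIntegrable a g) (c : ℂ) :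
    HankelIntegrable a (fun w => c * g w) :=
  ⟨hg.cont.const_mul c, hg.upper.const_mul c, hg.lower.const_mul c⟩

theorem hankel_add {a : ℝ} {g h : ℂ → ℂ} (hg : HankelIntegrable a g)
    (hh : HankelIntegrable a h) : hankel a (fun w => g w + h w) = hankel a g + hankel a h := by
  have h1 := hg.cont
  have h2 := hh.cont
  have h3 : ∫ x in Ioi a, ((g (x + ang * Complex.I) + h (x + ang * Complex.I)) -
      (g (x + (-ang : ℝ) * Complex.I) + h (x + (-ang : ℝ) * Complex.I))) =
      (∫ x in Ioi a, (g (x + ang * Complex.I) - g (x + (-ang : ℝ) * Complex.I))) +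
      ∫ x in Ioi a, (h (x + ang * Complex.I) - h (x + (-ang : ℝ) * Complex.I)) := by
    refine Eq.trans ?_ (integral_add (hg.upper.sub hg.lower) (hh.upper.sub hh.lower))
    congr 1 with x
    ring
  have h4 : ∫ y in (-ang)..ang, (g (a + y * Complex.I) + h (a + y * Complex.I)) =
      (∫ y in (-ang)..ang, g (a + y * Complex.I)) + ∫ y in (-ang)..ang, h (a + y * Complex.I) :=
    intervalIntegral.integral_add ((by fun_prop : Continuous _).intervalIntegrable _ _)
      ((by fun_prop : Continuous _).intervalIntegrable _ _)
  rw [hankel, h3, h4, hankel, hankel]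
  ring

theorem hankel_const_mul (a : ℝ) (g : ℂ → ℂ) (c : ℂ) :
    hankel a (fun w => c * g w) = c * hankel a g := by
  simp only [hankel, ← mul_sub]
  rw [integral_const_mul, intervalIntegral.integral_const_mul]
  ring

theorem hankel_sum {a : ℝ} {g : ℕ → ℂ → ℂ} (c : ℕ → ℂ) (hg : ∀ k, HankelIntegrable a (g k))
    (n : ℕ) : HankelIntegrable a (fun w => ∑ k ∈ Finset.range n, c k * g k w) ∧
      hankel a (fun w => ∑ k ∈ Finset.range n, c k * g k w) =
      ∑ k ∈ Finset.range n, c k * hankel a (g k) := by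
  induction n with
  | zero => exact ⟨⟨by simp [continuous_const], by simp, by simp⟩, by simp [hankel]⟩
  | succ n ih =>
    simp only [Finset.sum_range_succ]
    refine ⟨ih.1.add ((hg n).const_mul _), ?_⟩
    rw [hankel_add ih.1 ((hg n).const_mul _), ih.2, hankel_const_mul]

/-- The contour integral of an exact differential vanishes. -/
theorem hankel_deriv_eq_zero {a : ℝ} {g g' : ℂ → ℂ} (hg : ∀ w, HasDerivAt g (g' w) w)
    (hint : HankelIntegrable a g')
    (hp : Tendsto (fun x : ℝ => g (x + ang * Complex.I)) atTop (𝓝 0))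
    (hm : Tendsto (fun x : ℝ => g (x + (-ang : ℝ) * Complex.I)) atTop (𝓝 0)) :
    hankel a g' = 0 := by
  have hline : ∀ y x : ℝ, HasDerivAt (fun x : ℝ => g (x + y * Complex.I))
      (g' (x + y * Complex.I)) x := fun y x => by
    have h1 : HasDerivAt (fun x : ℝ => (x : ℂ) + y * Complex.I) 1 x :=
      (Complex.ofRealCLM.hasDerivAt (x := x)).add_const _
    simpa [Function.comp_def] using (hg _).scomp x h1
  have hvert : ∀ y : ℝ, HasDerivAt (fun y : ℝ => g (a + y * Complex.I))
      (Complex.I * g' (a + y * Complex.I)) y := fun y => by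
    have h1 : HasDerivAt (fun y : ℝ => (a : ℂ) + y * Complex.I) Complex.I y := by
      simpa using ((Complex.ofRealCLM.hasDerivAt (x := y)).mul_const Complex.I).const_add (a : ℂ)
    exact (hg _).scomp y h1
  have h1 := integral_Ioi_of_hasDerivAt_of_tendsto' (fun x _ => hline ang x) hint.upper hp
  have h2 := integral_Ioi_of_hasDerivAt_of_tendsto' (fun x _ => hline (-ang) x) hint.lower hm
  have hc := hint.cont
  have h3 := intervalIntegral.integral_eq_sub_of_hasDerivAt (a := -ang) (b := ang)
    (fun y _ => hvert y) ((by fun_prop : Continuous _).intervalIntegrable _ _)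
  rw [intervalIntegral.integral_const_mul] at h3
  rw [hankel, integral_sub hint.upper hint.lower, h1, h2, h3]
  ring

/-! ### Hankel's formula for the reciprocal Gamma function -/

theorem cos_ang' : Real.cos (-ang) = -(1 / 2) := by rw [Real.cos_neg, cos_ang]

/-- The integrand of Hankel's formula for `1 / Γ(s)`, in the logarithmic coordinate. -/
def gammaKernel (s : ℝ) (w : ℂ) : ℂ := Complex.exp (Complex.exp w + (1 - s : ℝ) * w)

theorem differentiable_gammaKernel (s : ℝ) : Differentiable ℂ (gammaKernel s) := by
  unfold gammaKernel; fun_prop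

theorem norm_gammaKernel (s x y : ℝ) : ‖gammaKernel s (x + y * Complex.I)‖ =
    Real.exp ((1 - s) * x) * Real.exp (Real.cos y * Real.exp x) := norm_exp_exp_line _ _ _

theorem norm_gammaKernel_upper (s x : ℝ) : ‖gammaKernel s (x + ang * Complex.I)‖ =
    Real.exp ((1 - s) * x) * Real.exp (-(1 / 2) * Real.exp x) := by
  rw [norm_gammaKernel, cos_ang]

theorem norm_gammaKernel_lower (s x : ℝ) : ‖gammaKernel s (x + (-ang : ℝ) * Complex.I)‖ =
    Real.exp ((1 - s) * x) * Real.exp (-(1 / 2) * Real.exp x) := by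
  rw [norm_gammaKernel, cos_ang']

/-- On a half-line in `x ≥ 0` any exponent `b` is admissible, being dominated there by the positive
exponent `|b| + 1`. -/
theorem integrableOn_exp_mul_exp_neg_exp {a : ℝ} (ha : 0 ≤ a) (b : ℝ) {c : ℝ} (hc : 0 < c) :
    IntegrableOn (fun x : ℝ => Real.exp (b * x) * Real.exp (-c * Real.exp x)) (Ioi a) := by
  refine (integrable_exp_mul_exp_neg_exp (b := |b| + 1) (by positivity) hc).integrableOn.mono'
    (by fun_prop) ?_
  filter_upwards [ae_restrict_mem measurableSet_Ioi] with x hx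
  have hx0 : 0 ≤ x := ha.trans (le_of_lt hx)
  rw [Real.norm_of_nonneg (by positivity)]
  have : b * x ≤ (|b| + 1) * x := by
    apply mul_le_mul_of_nonneg_right _ hx0
    linarith [le_abs_self b]
  gcongr

theorem hankelIntegrable_gammaKernel {a : ℝ} (ha : 0 ≤ a) (s : ℝ) :
    HankelIntegrable a (gammaKernel s) := by
  have hc := (differentiable_gammaKernel s).continuous
  refine ⟨hc, ?_, ?_⟩
  · refine (integrableOn_exp_mul_exp_neg_exp ha (1 - s) (by norm_num : (0 : ℝ) < 1 / 2)).mono'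
      (by fun_prop) (Eventually.of_forall fun x => (norm_gammaKernel_upper s x).le)
  · refine (integrableOn_exp_mul_exp_neg_exp ha (1 - s) (by norm_num : (0 : ℝ) < 1 / 2)).mono'
      (by fun_prop) (Eventually.of_forall fun x => (norm_gammaKernel_lower s x).le)

/-- Integration by parts: the derivative of `gammaKernel (s + 1)` is `gammaKernel s - s *
gammaKernel (s + 1)`, and its contour integral vanishes. This matches the recurrence of `1/Γ`. -/
theorem hankel_gammaKernel_succ {a : ℝ} (ha : 0 ≤ a) (s : ℝ) :
    hankel a (gammaKernel s) = s * hankel a (gammaKernel (s + 1)) := by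
  have hs := hankelIntegrable_gammaKernel ha s
  have hs' := (hankelIntegrable_gammaKernel ha (s + 1)).const_mul (-s)
  have hd : ∀ w, HasDerivAt (gammaKernel (s + 1))
      (gammaKernel s w + -s * gammaKernel (s + 1) w) w := by
    intro w
    have h1 : HasDerivAt (fun w => Complex.exp w + ((1 - (s + 1) : ℝ) : ℂ) * w)
        (Complex.exp w + ((1 - (s + 1) : ℝ) : ℂ)) w := by
      simpa only [id, mul_one] using! (Complex.hasDerivAt_exp w).add
        ((hasDerivAt_id w).const_mul ((1 - (s + 1) : ℝ) : ℂ))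
    refine h1.cexp.congr_deriv ?_
    unfold gammaKernel
    rw [show Complex.exp w + ((1 - s : ℝ) : ℂ) * w =
      (Complex.exp w + ((1 - (s + 1) : ℝ) : ℂ) * w) + w by push_cast; ring, Complex.exp_add _ w]
    push_cast
    ring
  have key := hankel_deriv_eq_zero (a := a) hd (hs.add hs')
    (by
      rw [tendsto_zero_iff_norm_tendsto_zero]
      simp_rw [norm_gammaKernel_upper]
      exact tendsto_exp_mul_exp_neg_exp_atTop _ (by norm_num))
    (by
      rw [tendsto_zero_iff_norm_tendsto_zero]
      simp_rw [norm_gammaKernel_lower]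
      exact tendsto_exp_mul_exp_neg_exp_atTop _ (by norm_num))
  rw [hankel_add hs hs', hankel_const_mul] at key
  linear_combination key

theorem integral_gammaKernel_upper {s : ℝ} (hs : s < 1) :
    ∫ x : ℝ, gammaKernel s (x + ang * Complex.I) =
      Complex.exp (Real.pi * (1 - s : ℝ) * Complex.I) * Real.Gamma (1 - s) :=
  integral_exp_exp_line (by linarith) pi_div_two_lt_ang ang_lt_pi.le

theorem gammaKernel_lower_eq_conj (s x : ℝ) : gammaKernel s (x + (-ang : ℝ) * Complex.I) =
    (starRingEnd ℂ) (gammaKernel s (x + ang * Complex.I)) := by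
  simp [gammaKernel, ← Complex.exp_conj]

theorem integrable_gammaKernel {s : ℝ} (hs : s < 1) :
    Integrable (fun x : ℝ => gammaKernel s (x + ang * Complex.I)) := by
  have hc := (differentiable_gammaKernel s).continuous
  exact (integrable_exp_mul_exp_neg_exp (b := 1 - s) (by linarith)
    (by norm_num : (0 : ℝ) < 1 / 2)).mono' (by fun_prop)
    (Eventually.of_forall fun x => (norm_gammaKernel_upper s x).le)

/-- The integrands on the two rays are complex conjugate, so the difference is `2i` times an
imaginary part. -/
theorem integral_gammaKernel_sub {s : ℝ} (hs : s < 1) :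
    (∫ x : ℝ, gammaKernel s (x + ang * Complex.I)) -
      ∫ x : ℝ, gammaKernel s (x + (-ang : ℝ) * Complex.I) =
      2 * Complex.I * (Real.sin (Real.pi * (1 - s)) * Real.Gamma (1 - s) : ℝ) := by
  simp_rw [gammaKernel_lower_eq_conj]
  rw [integral_conj, Complex.sub_conj, integral_gammaKernel_upper hs, Complex.im_mul_ofReal,
    ← Complex.ofReal_mul, Complex.exp_ofReal_mul_I_im]
  push_cast
  ring

theorem norm_exp_exp_le_of_le {x y a : ℝ} (hx : x ≤ a) :
    Real.exp (Real.cos y * Real.exp x) ≤ Real.exp (Real.exp a) := by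
  have h1 := Real.cos_le_one y
  have h2 := Real.exp_pos x
  have h3 := Real.exp_le_exp.2 hx
  exact Real.exp_le_exp.2 (by nlinarith)

theorem tendsto_const_mul_exp_atBot (c : ℝ) {b : ℝ} (hb : 0 < b) :
    Tendsto (fun x : ℝ => c * Real.exp (b * x)) atBot (𝓝 0) := by
  simpa using (Real.tendsto_exp_atBot.comp (tendsto_id.const_mul_atBot hb)).const_mul c

/-- For `s < 1` the factor `exp ((1 - s) w)` vanishes at `-∞`, so the arc can be shrunk away;
Euler's reflection formula identifies the result. -/
theorem hankel_gammaKernel_of_lt_one {a s : ℝ} (hs0 : 0 < s) (hs : s < 1) :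
    hankel a (gammaKernel s) = 2 * Real.pi * Complex.I * (Real.Gamma s)⁻¹ := by
  rw [hankel_eq_integral_lines (B := fun x => Real.exp (Real.exp a) * Real.exp ((1 - s) * x)) a
    (fun w _ => differentiable_gammaKernel s w) (integrable_gammaKernel hs)
    ((integrable_gammaKernel hs).norm.mono'
      (by have hc := (differentiable_gammaKernel s).continuous; fun_prop)
      (Eventually.of_forall fun x => by rw [norm_gammaKernel_upper, norm_gammaKernel_lower]))
    (fun x hx y _ => by
      rw [norm_gammaKernel, mul_comm]
      exact mul_le_mul_of_nonneg_right (norm_exp_exp_le_of_le hx) (Real.exp_pos _).le)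
    (tendsto_const_mul_exp_atBot _ (by linarith)), integral_gammaKernel_sub hs]
  have h := Real.Gamma_mul_Gamma_one_sub s
  have hsin : Real.sin (Real.pi * s) ≠ 0 :=
    (Real.sin_pos_of_pos_of_lt_pi (by positivity) (by nlinarith [Real.pi_pos])).ne'
  have h0 := (Real.Gamma_pos_of_pos hs0).ne'
  have h3 : Real.sin (Real.pi * (1 - s)) * Real.Gamma (1 - s) = Real.pi * (Real.Gamma s)⁻¹ := by
    rw [mul_sub, mul_one, Real.sin_pi_sub]
    rw [eq_div_iff hsin] at h
    rw [← div_eq_mul_inv, eq_div_iff h0]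
    linarith
  rw [h3]
  push_cast
  ring

/-- At `s = 1` the integrand no longer vanishes at `-∞` and the arc cannot be discarded, so this
value of Hankel's formula is reached as a limit at fixed radius. -/
theorem tendsto_hankel_gammaKernel_one {a : ℝ} (ha : 0 ≤ a) :
    Tendsto (fun s => hankel a (gammaKernel s)) (𝓝[<] 1) (𝓝 (hankel a (gammaKernel 1))) := by
  have hmem : ∀ᶠ s : ℝ in 𝓝[<] 1, s ∈ Ioo (0 : ℝ) 1 := Ioo_mem_nhdsLT one_pos
  have hle : ∀ {s x : ℝ}, s ∈ Ioo (0 : ℝ) 1 → a ≤ x → Real.exp ((1 - s) * x) ≤ Real.exp (1 * x) :=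
    fun {s x} hs hx => Real.exp_le_exp.2
      (mul_le_mul_of_nonneg_right (by linarith [hs.1]) (ha.trans hx))
  refine tendsto_hankel (B := fun x => Real.exp (1 * x) * Real.exp (-(1 / 2) * Real.exp x))
    (C := Real.exp (1 * a) * Real.exp (Real.exp a))
    (Eventually.of_forall fun s => (differentiable_gammaKernel s).continuous) ?_ ?_
    (integrableOn_exp_mul_exp_neg_exp ha _ (by norm_num)) ?_ ?_
  · filter_upwards [hmem] with s hs x hx
    rw [norm_gammaKernel_upper]
    exact mul_le_mul_of_nonneg_right (hle hs hx.le) (Real.exp_pos _).le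
  · filter_upwards [hmem] with s hs x hx
    rw [norm_gammaKernel_lower]
    exact mul_le_mul_of_nonneg_right (hle hs hx.le) (Real.exp_pos _).le
  · filter_upwards [hmem] with s hs y _
    rw [norm_gammaKernel]
    exact mul_le_mul (hle hs le_rfl) (norm_exp_exp_le_of_le le_rfl) (Real.exp_pos _).le
      (Real.exp_pos _).le
  · intro x y _ _
    have : Continuous fun s : ℝ => gammaKernel s (x + y * Complex.I) := by
      unfold gammaKernel; fun_prop
    exact (this.tendsto 1).mono_left nhdsWithin_le_nhds

/-- Hankel's formula. -/
theorem hankel_gammaKernel {a s : ℝ} (ha : 0 ≤ a) (hs : 0 < s) :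
    hankel a (gammaKernel s) = 2 * Real.pi * Complex.I * (Real.Gamma s)⁻¹ := by
  have base : ∀ s : ℝ, 0 < s → s ≤ 1 →
      hankel a (gammaKernel s) = 2 * Real.pi * Complex.I * (Real.Gamma s)⁻¹ := by
    intro s hs hs1
    rcases hs1.lt_or_eq with h | rfl
    · exact hankel_gammaKernel_of_lt_one hs h
    · refine tendsto_nhds_unique (tendsto_hankel_gammaKernel_one ha) ?_
      have h1 : ContinuousAt (fun s : ℝ => 2 * Real.pi * Complex.I * (((Real.Gamma s)⁻¹ : ℝ) : ℂ))
          1 := by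
        have h2 : ContinuousAt Real.Gamma 1 :=
          (Real.differentiableAt_Gamma fun m => by
            have : (0 : ℝ) ≤ m := m.cast_nonneg
            linarith).continuousAt
        have h3 := h2.inv₀ (by simp)
        exact continuousAt_const.mul (Complex.continuous_ofReal.continuousAt.comp h3)
      have h4 := h1.tendsto.mono_left (nhdsWithin_le_nhds (s := Iio 1))
      refine h4.congr' ?_
      filter_upwards [Ioo_mem_nhdsLT (one_pos : (0 : ℝ) < 1)] with s hs
      exact (hankel_gammaKernel_of_lt_one hs.1 hs.2).symm
  -- The recurrence carries the formula from `(0, 1]` to all positive `s`, one unit at a time.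
  have step : ∀ n : ℕ, ∀ s : ℝ, 0 < s → s ≤ n + 1 →
      hankel a (gammaKernel s) = 2 * Real.pi * Complex.I * (Real.Gamma s)⁻¹ := by
    intro n
    induction n with
    | zero => intro s hs h; exact base s hs (by simpa using h)
    | succ n ih =>
      intro s hs h
      rcases le_or_gt s 1 with h1 | h1
      · exact base s hs h1
      · have h2 := ih (s - 1) (by linarith) (by push_cast at h; linarith)
        have h3 := hankel_gammaKernel_succ ha (s - 1)
        have h4 := Real.Gamma_add_one (s := s - 1) (by linarith)
        rw [sub_add_cancel] at h3 h4
        have h5 : ((s - 1 : ℝ) : ℂ) ≠ 0 := by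
          rw [Complex.ofReal_ne_zero]; linarith
        have h6 : (Real.Gamma (s - 1) : ℂ) ≠ 0 := by
          rw [Complex.ofReal_ne_zero]; exact (Real.Gamma_pos_of_pos (by linarith)).ne'
        rw [h2] at h3
        rw [h4]
        push_cast at h3 h5 ⊢
        field_simp at h3 ⊢
        linear_combination -h3
  exact step ⌈s⌉₊ s hs ((Nat.le_ceil s).trans (by linarith))

/-! ### The Mittag-Leffler function `E_{ρ,ρ}` -/

/-- Log-convexity of `Γ` applied to `x = ρ (x + ρ - 1) + (1 - ρ)(x + ρ)`. It supplies the ratio test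
for the Mittag-Leffler series. -/
theorem Gamma_le_Gamma_add_mul_rpow {ρ x : ℝ} (hρ : 0 < ρ) (hρ1 : ρ ≤ 1) (hx : 1 < x) :
    Real.Gamma x ≤ Real.Gamma (x + ρ) * (x + ρ - 1) ^ (-ρ) := by
  have h0 : 0 < x + ρ - 1 := by linarith
  have h1 : Real.Gamma (x + ρ) = (x + ρ - 1) * Real.Gamma (x + ρ - 1) := by
    rw [← Real.Gamma_add_one h0.ne', sub_add_cancel]
  rcases hρ1.lt_or_eq with h | rfl
  · have h2 := Real.Gamma_mul_add_mul_le_rpow_Gamma_mul_rpow_Gamma (s := x + ρ - 1) (t := x + ρ)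
      (a := ρ) (b := 1 - ρ) h0 (by linarith) hρ (by linarith) (by ring)
    rw [show ρ * (x + ρ - 1) + (1 - ρ) * (x + ρ) = x by ring] at h2
    refine h2.trans_eq ?_
    have hG : 0 < Real.Gamma (x + ρ) := Real.Gamma_pos_of_pos (by linarith)
    rw [show Real.Gamma (x + ρ - 1) = Real.Gamma (x + ρ) / (x + ρ - 1) by
      rw [h1]; field_simp, Real.div_rpow hG.le h0.le, div_mul_eq_mul_div, ← Real.rpow_add hG,
      Real.rpow_neg h0.le]
    simp [div_eq_mul_inv]
  · rw [h1, Real.rpow_neg_one]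
    field_simp
    simp

theorem summable_pow_div_Gamma {ρ b : ℝ} (hρ : 0 < ρ) (hρ1 : ρ ≤ 1) (R : ℝ) :
    Summable fun k : ℕ => R ^ k / Real.Gamma (ρ * k + b) := by
  have hlim : Tendsto (fun k : ℕ => ρ * k + b) atTop atTop :=
    tendsto_atTop_add_const_right _ _ (tendsto_natCast_atTop_atTop.const_mul_atTop hρ)
  have hlim2 : Tendsto (fun k : ℕ => |R| * (ρ * k + b + ρ - 1) ^ (-ρ)) atTop (𝓝 0) := by
    have := ((tendsto_rpow_neg_atTop hρ).comp
      (tendsto_atTop_add_const_right _ (ρ - 1) hlim)).const_mul |R|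
    rw [mul_zero] at this
    refine this.congr fun k => ?_
    simp [add_sub_assoc]
  refine summable_of_ratio_norm_eventually_le (r := 1 / 2) (by norm_num) ?_
  filter_upwards [hlim.eventually_gt_atTop 1,
    hlim2.eventually_le_const (by norm_num : (0 : ℝ) < 1 / 2)] with k h1 h2
  have hG := Gamma_le_Gamma_add_mul_rpow hρ hρ1 h1
  have hG0 : 0 < Real.Gamma (ρ * k + b) := Real.Gamma_pos_of_pos (by linarith)
  have hG1 : 0 < Real.Gamma (ρ * k + b + ρ) := Real.Gamma_pos_of_pos (by linarith)
  have hcast : ρ * ((k + 1 : ℕ) : ℝ) + b = ρ * k + b + ρ := by push_cast; ring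
  rw [hcast, norm_div, norm_div, Real.norm_of_nonneg hG0.le, Real.norm_of_nonneg hG1.le, norm_pow,
    norm_pow, Real.norm_eq_abs, pow_succ, ← mul_div_assoc, div_le_div_iff₀ hG1 hG0]
  calc |R| ^ k * |R| * Real.Gamma (ρ * k + b)
      ≤ |R| ^ k * |R| * (Real.Gamma (ρ * k + b + ρ) * (ρ * k + b + ρ - 1) ^ (-ρ)) := by gcongr
    _ = |R| ^ k * Real.Gamma (ρ * k + b + ρ) * (|R| * (ρ * k + b + ρ - 1) ^ (-ρ)) := by ring
    _ ≤ |R| ^ k * Real.Gamma (ρ * k + b + ρ) * (1 / 2) := by gcongr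
    _ = _ := by ring

/-- `E_{ρ,ρ}(-μ)`, where `E` is the two-parameter Mittag-Leffler function. -/
def ml (ρ μ : ℝ) : ℝ := ∑' k : ℕ, (-μ) ^ k / Real.Gamma (ρ * k + ρ)

/-- With `r = |exp ζ|` and `cos (Im ζ) ≥ -√2/2`, the squared norm is at least `(r - μ√2/2)² + μ²/2`.
This keeps the denominators of all later kernels away from zero, uniformly in `r`. -/
theorem norm_exp_add_ge {ζ : ℂ} {μ : ℝ} (hζ : |ζ.im| ≤ 3 * Real.pi / 4) (hμ : 0 ≤ μ) :
    μ / 2 ≤ ‖Complex.exp ζ + μ‖ := by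
  have hcos : -(√2 / 2) ≤ Real.cos ζ.im := by
    rw [← Real.cos_abs, ← Real.cos_pi_div_four, ← Real.cos_pi_sub]
    exact Real.cos_le_cos_of_nonneg_of_le_pi (abs_nonneg _) (by linarith [Real.pi_pos])
      (by linarith)
  have hsq : ‖Complex.exp ζ + μ‖ ^ 2 =
      Real.exp ζ.re ^ 2 + 2 * μ * (Real.exp ζ.re * Real.cos ζ.im) + μ ^ 2 := by
    rw [Complex.sq_norm, Complex.normSq_apply]
    simp only [Complex.add_re, Complex.add_im, Complex.exp_re, Complex.exp_im, Complex.ofReal_re,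
      Complex.ofReal_im]
    nlinarith [Real.sin_sq_add_cos_sq ζ.im]
  refine le_of_sq_le_sq ?_ (norm_nonneg _)
  rw [hsq]
  have hr := Real.exp_pos ζ.re
  have h1 : 2 * μ * (Real.exp ζ.re * -(√2 / 2)) ≤ 2 * μ * (Real.exp ζ.re * Real.cos ζ.im) := by
    gcongr
  have h2 : √2 ^ 2 = 2 := Real.sq_sqrt (by norm_num)
  nlinarith [sq_nonneg (Real.exp ζ.re - μ * (√2 / 2))]

/-- The integrand of the contour representation of `E_{ρ,ρ}(-μ)`. -/
def mlKernel (ρ μ : ℝ) (w : ℂ) : ℂ :=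
  Complex.exp (Complex.exp w + w) / (Complex.exp (ρ * w) + μ)

theorem norm_exp_exp_add_line (x y : ℝ) :
    ‖Complex.exp (Complex.exp (x + y * Complex.I) + (x + y * Complex.I))‖ =
      Real.exp (1 * x) * Real.exp (Real.cos y * Real.exp x) := by
  simpa using norm_exp_exp_line 1 x y

theorem abs_im_mul_le {ρ : ℝ} {w : ℂ} (hρ : 0 < ρ) (hρ1 : ρ ≤ 1) (hw : w.im ∈ Icc (-ang) ang) :
    |((ρ : ℂ) * w).im| ≤ 3 * Real.pi / 4 := by
  rw [Complex.im_ofReal_mul, abs_mul, abs_of_pos hρ]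
  have h1 : |w.im| ≤ ang := abs_le.2 hw
  have h2 : ρ * |w.im| ≤ 1 * ang := by gcongr
  have h3 : ang ≤ 3 * Real.pi / 4 := by unfold ang; linarith [Real.pi_pos]
  linarith

theorem norm_mlKernel_le {ρ μ : ℝ} {w : ℂ} (hρ : 0 < ρ) (hρ1 : ρ ≤ 1) (hμ : 0 < μ)
    (hw : w.im ∈ Icc (-ang) ang) :
    ‖mlKernel ρ μ w‖ ≤ 2 / μ * ‖Complex.exp (Complex.exp w + w)‖ := by
  have h := norm_exp_add_ge (abs_im_mul_le hρ hρ1 hw) hμ.le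
  rw [mlKernel, norm_div, div_eq_inv_mul]
  gcongr
  rw [← inv_div]
  exact inv_anti₀ (by positivity) h

theorem mlKernel_denom_ne_zero {ρ μ : ℝ} {w : ℂ} (hρ : 0 < ρ) (hρ1 : ρ ≤ 1) (hμ : 0 < μ)
    (hw : w.im ∈ Icc (-ang) ang) : Complex.exp (ρ * w) + μ ≠ 0 := by
  have h := norm_exp_add_ge (abs_im_mul_le hρ hρ1 hw) hμ.le
  rw [← norm_pos_iff]
  linarith

theorem differentiableAt_mlKernel {ρ μ : ℝ} {w : ℂ} (hρ : 0 < ρ) (hρ1 : ρ ≤ 1) (hμ : 0 < μ)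
    (hw : w.im ∈ Icc (-ang) ang) : DifferentiableAt ℂ (mlKernel ρ μ) w := by
  unfold mlKernel
  have := mlKernel_denom_ne_zero hρ hρ1 hμ hw
  fun_prop (disch := assumption)

theorem ang_mem : ang ∈ Icc (-ang) ang := by constructor <;> linarith [ang_pos]

theorem neg_ang_mem : -ang ∈ Icc (-ang) ang := by constructor <;> linarith [ang_pos]

theorem im_line (x y : ℝ) : ((x : ℂ) + y * Complex.I).im = y := by simp

theorem continuous_mlKernel_line {ρ μ y : ℝ} (hρ : 0 < ρ) (hρ1 : ρ ≤ 1) (hμ : 0 < μ)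
    (hy : y ∈ Icc (-ang) ang) : Continuous fun x : ℝ => mlKernel ρ μ (x + y * Complex.I) := by
  rw [continuous_iff_continuousAt]
  intro x
  exact ContinuousAt.comp (f := fun x : ℝ => (x : ℂ) + y * Complex.I)
    (differentiableAt_mlKernel hρ hρ1 hμ (by rwa [im_line])).continuousAt (by fun_prop)

theorem integrable_exp_mul_exp_half :
    Integrable fun x : ℝ => Real.exp (1 * x) * Real.exp (-(1 / 2) * Real.exp x) :=
  integrable_exp_mul_exp_neg_exp one_pos (by norm_num)

theorem integrable_mlKernel {ρ μ y : ℝ} (hρ : 0 < ρ) (hρ1 : ρ ≤ 1) (hμ : 0 < μ)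
    (hy : y ∈ Icc (-ang) ang) (hcos : Real.cos y = -(1 / 2)) :
    Integrable fun x : ℝ => mlKernel ρ μ (x + y * Complex.I) := by
  refine (integrable_exp_mul_exp_half.const_mul (2 / μ)).mono'
    (continuous_mlKernel_line hρ hρ1 hμ hy).aestronglyMeasurable (Eventually.of_forall fun x => ?_)
  refine (norm_mlKernel_le hρ hρ1 hμ (by rwa [im_line])).trans_eq ?_
  rw [norm_exp_exp_add_line, hcos]

theorem mlKernel_lower_eq_conj (ρ μ x : ℝ) : mlKernel ρ μ (x + (-ang : ℝ) * Complex.I) =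
    (starRingEnd ℂ) (mlKernel ρ μ (x + ang * Complex.I)) := by
  simp [mlKernel, ← Complex.exp_conj]

/-- The denominator has no zero in the strip and the factor `exp w` vanishes at `-∞`, so the arc
disappears and the result does not depend on `a`. Conjugate symmetry of the rays leaves an imaginary
part. -/
theorem hankel_mlKernel {ρ μ : ℝ} (hρ : 0 < ρ) (hρ1 : ρ ≤ 1) (hμ : 0 < μ) (a : ℝ) :
    hankel a (mlKernel ρ μ) =
      2 * Complex.I * (∫ x : ℝ, (mlKernel ρ μ (x + ang * Complex.I)).im : ℝ) := by
  have hint := integrable_mlKernel hρ hρ1 hμ ang_mem cos_ang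
  rw [hankel_eq_integral_lines
    (B := fun x => 2 / μ * Real.exp (Real.exp a) * Real.exp (1 * x)) a
    (fun w hw => differentiableAt_mlKernel hρ hρ1 hμ hw) hint
    (integrable_mlKernel hρ hρ1 hμ neg_ang_mem cos_ang')
    (fun x hx y hy => by
      refine (norm_mlKernel_le hρ hρ1 hμ (by rwa [im_line])).trans ?_
      rw [norm_exp_exp_add_line, mul_assoc, mul_comm (Real.exp (Real.exp a))]
      have := norm_exp_exp_le_of_le (y := y) hx
      have h2 : 0 ≤ 2 / μ := by positivity
      exact mul_le_mul_of_nonneg_left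
        (mul_le_mul_of_nonneg_left this (Real.exp_pos _).le) h2)
    (tendsto_const_mul_exp_atBot _ one_pos)]
  simp_rw [mlKernel_lower_eq_conj]
  rw [integral_conj, Complex.sub_conj]
  have : (∫ x : ℝ, mlKernel ρ μ (x + ang * Complex.I)).im =
      ∫ x : ℝ, (mlKernel ρ μ (x + ang * Complex.I)).im :=
    (integral_im (𝕜 := ℂ) hint).symm
  rw [this]
  push_cast
  ring

/-- With `z = exp w`, this exhibits the `k`-th Hankel integrand as a term of the geometric series of
`1/(z^ρ + μ)` in powers of `z^(-ρ)`. -/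
theorem gammaKernel_eq_mul_pow (ρ : ℝ) (k : ℕ) (w : ℂ) : gammaKernel (ρ * k + ρ) w =
    Complex.exp (Complex.exp w + w) * Complex.exp (-(ρ * w)) * Complex.exp (-(ρ * w)) ^ k := by
  rw [gammaKernel, ← Complex.exp_nat_mul, ← Complex.exp_add, ← Complex.exp_add]
  congr 1
  push_cast
  ring

/-- Outside the radius `exp a` the common ratio has modulus at most `1/2`, so the partial sums have
a majorant free of `n`. -/
theorem norm_partial_sum_gammaKernel_le {ρ μ a : ℝ} {w : ℂ} (hρ : 0 < ρ) (hμ : 0 < μ) (ha : 0 ≤ a)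
    (haμ : μ * Real.exp (-(ρ * a)) ≤ 1 / 2) (hw : a ≤ w.re) (n : ℕ) :
    ‖∑ k ∈ Finset.range n, (-μ : ℂ) ^ k * gammaKernel (ρ * k + ρ) w‖ ≤
      2 * ‖Complex.exp (Complex.exp w + w)‖ := by
  set q := ‖Complex.exp (-(ρ * w))‖ with hq
  have hqe : q = Real.exp (-(ρ * w.re)) := by rw [hq, Complex.norm_exp]; simp
  have hqa : q ≤ Real.exp (-(ρ * a)) := by rw [hqe]; gcongr
  have hq1 : q ≤ 1 := hqa.trans (Real.exp_le_one_iff.2 (by nlinarith))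
  have hr : μ * q ≤ 1 / 2 := le_trans (by gcongr) haμ
  have hr0 : 0 ≤ μ * q := by positivity
  calc _ ≤ ∑ k ∈ Finset.range n, ‖Complex.exp (Complex.exp w + w)‖ * (1 / 2) ^ k := by
        refine (norm_sum_le _ _).trans (Finset.sum_le_sum fun k _ => ?_)
        rw [gammaKernel_eq_mul_pow, norm_mul, norm_mul, norm_mul, norm_pow, norm_pow, ← hq, norm_neg,
          Complex.norm_real, Real.norm_of_nonneg hμ.le]
        calc μ ^ k * (‖Complex.exp (Complex.exp w + w)‖ * q * q ^ k)
            = ‖Complex.exp (Complex.exp w + w)‖ * q * (μ * q) ^ k := by rw [mul_pow]; ring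
          _ ≤ ‖Complex.exp (Complex.exp w + w)‖ * 1 * (1 / 2) ^ k := by gcongr
          _ = _ := by ring
    _ = ‖Complex.exp (Complex.exp w + w)‖ * ∑ k ∈ Finset.range n, (1 / 2 : ℝ) ^ k := by
        rw [Finset.mul_sum]
    _ ≤ ‖Complex.exp (Complex.exp w + w)‖ * 2 := by
        gcongr; exact sum_geometric_two_le n
    _ = _ := mul_comm _ _

theorem tendsto_partial_sum_gammaKernel {ρ μ a : ℝ} {w : ℂ} (hρ : 0 < ρ) (hρ1 : ρ ≤ 1) (hμ : 0 < μ)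
    (haμ : μ * Real.exp (-(ρ * a)) ≤ 1 / 2) (hw : a ≤ w.re) (hw' : w.im ∈ Icc (-ang) ang) :
    Tendsto (fun n => ∑ k ∈ Finset.range n, (-μ : ℂ) ^ k * gammaKernel (ρ * k + ρ) w) atTop
      (𝓝 (mlKernel ρ μ w)) := by
  set q := Complex.exp (-(ρ * w)) with hq
  have hr : ‖-μ * q‖ < 1 := by
    rw [norm_mul, norm_neg, Complex.norm_real, Real.norm_of_nonneg hμ.le, hq, Complex.norm_exp]
    have : Real.exp (-((ρ : ℂ) * w)).re ≤ Real.exp (-(ρ * a)) := by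
      simp only [Complex.neg_re, Complex.re_ofReal_mul]
      gcongr
    have h2 := mul_le_mul_of_nonneg_left this hμ.le
    linarith
  have h1 := ((hasSum_geometric_of_norm_lt_one hr).mul_left
    (Complex.exp (Complex.exp w + w) * q)).tendsto_sum_nat
  have h2 : Complex.exp (Complex.exp w + w) * q * (1 - -μ * q)⁻¹ = mlKernel ρ μ w := by
    have h3 := mlKernel_denom_ne_zero hρ hρ1 hμ hw'
    have h4 : Complex.exp (ρ * w) * q = 1 := by
      rw [hq, ← Complex.exp_add]; simp
    have h5 : (1 - -μ * q) = (Complex.exp (ρ * w) + μ) * q := by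
      rw [add_mul, h4]; ring
    have h6 : q ≠ 0 := Complex.exp_ne_zero _
    rw [h5, mlKernel]
    field_simp
  rw [h2] at h1
  refine h1.congr fun n => Finset.sum_congr rfl fun k _ => ?_
  rw [gammaKernel_eq_mul_pow, ← hq, mul_pow]
  ring

theorem exists_large_radius {ρ : ℝ} (hρ : 0 < ρ) (μ : ℝ) :
    ∃ a : ℝ, 0 ≤ a ∧ μ * Real.exp (-(ρ * a)) ≤ 1 / 2 := by
  have h : Tendsto (fun a : ℝ => μ * Real.exp (-(ρ * a))) atTop (𝓝 0) := by
    simpa using (Real.tendsto_exp_neg_atTop_nhds_zero.comp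
      (tendsto_id.const_mul_atTop hρ)).const_mul μ
  obtain ⟨a, h1, h2⟩ := ((eventually_ge_atTop 0).and
    (h.eventually_le_const (by norm_num : (0 : ℝ) < 1 / 2))).exists
  exact ⟨a, h1, h2⟩

/-- The contour representation of the Mittag-Leffler function. -/
theorem pi_mul_ml {ρ μ : ℝ} (hρ : 0 < ρ) (hρ1 : ρ ≤ 1) (hμ : 0 < μ) :
    Real.pi * ml ρ μ = ∫ x : ℝ, (mlKernel ρ μ (x + ang * Complex.I)).im := by
  -- The radius is taken large enough, depending on `μ`, for the geometric series to converge on the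
  -- whole contour. Once the sum is identified, `hankel_mlKernel` removes this dependence.
  obtain ⟨a, ha, haμ⟩ := exists_large_radius hρ μ
  have hsum := fun n => hankel_sum (a := a) (g := fun k => gammaKernel (ρ * k + ρ))
    (fun k => (-μ : ℂ) ^ k) (fun k => hankelIntegrable_gammaKernel ha _) n
  have h1 : Tendsto (fun n => hankel a fun w =>
      ∑ k ∈ Finset.range n, (-μ : ℂ) ^ k * gammaKernel (ρ * k + ρ) w) atTop
      (𝓝 (hankel a (mlKernel ρ μ))) := by
    refine tendsto_hankel
      (B := fun x => 2 * (Real.exp (1 * x) * Real.exp (-(1 / 2) * Real.exp x)))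
      (C := 2 * (Real.exp (1 * a) * Real.exp (Real.exp a)))
      (Eventually.of_forall fun n => (hsum n).1.cont) ?_ ?_
      ((integrableOn_exp_mul_exp_neg_exp ha _ (by norm_num)).const_mul 2) ?_ ?_
    · refine Eventually.of_forall fun n x hx => ?_
      refine (norm_partial_sum_gammaKernel_le hρ hμ ha haμ (by simpa using hx.le) n).trans_eq ?_
      rw [norm_exp_exp_add_line, cos_ang]
    · refine Eventually.of_forall fun n x hx => ?_
      refine (norm_partial_sum_gammaKernel_le hρ hμ ha haμ (by simpa using hx.le) n).trans_eq ?_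
      rw [norm_exp_exp_add_line, cos_ang']
    · refine Eventually.of_forall fun n y _ => ?_
      refine (norm_partial_sum_gammaKernel_le hρ hμ ha haμ (by simp) n).trans ?_
      rw [norm_exp_exp_add_line]
      gcongr 2 * (_ * ?_)
      exact norm_exp_exp_le_of_le le_rfl
    · intro x y hx hy
      exact tendsto_partial_sum_gammaKernel hρ hρ1 hμ haμ (by simpa using hx) (by rwa [im_line])
  have h2 : HasSum (fun k : ℕ => (-μ) ^ k / Real.Gamma (ρ * k + ρ)) (ml ρ μ) :=
    (summable_pow_div_Gamma hρ hρ1 _).hasSum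
  have h3 := ((Complex.hasSum_ofReal.2 h2).mul_left (2 * Real.pi * Complex.I)).tendsto_sum_nat
  have h4 := tendsto_nhds_unique h1 (h3.congr fun n => by
    rw [(hsum n).2]
    refine Finset.sum_congr rfl fun k _ => ?_
    rw [hankel_gammaKernel ha (by positivity)]
    push_cast
    ring)
  rw [hankel_mlKernel hρ hρ1 hμ] at h4
  have h5 : (2 * Complex.I) * ((∫ x : ℝ, (mlKernel ρ μ (x + ang * Complex.I)).im : ℝ) : ℂ) =
      (2 * Complex.I) * ((Real.pi * ml ρ μ : ℝ) : ℂ) := by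
    rw [h4]; push_cast; ring
  exact (Complex.ofReal_injective (mul_left_cancel₀ (by simp) h5)).symm

/-- In the line integral the reciprocal of the denominator is at most `2/μ`, while the path and the
rest of the integrand do not involve `μ`. -/
theorem exists_mul_abs_ml_le {ρ : ℝ} (hρ : 0 < ρ) (hρ1 : ρ ≤ 1) :
    ∃ C : ℝ, ∀ μ, 0 < μ → μ * |ml ρ μ| ≤ C := by
  refine ⟨2 * (∫ x : ℝ, Real.exp (1 * x) * Real.exp (-(1 / 2) * Real.exp x)) / Real.pi,
    fun μ hμ => ?_⟩
  rw [le_div_iff₀ Real.pi_pos]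
  have h1 := pi_mul_ml hρ hρ1 hμ
  have h2 : |Real.pi * ml ρ μ| ≤
      2 / μ * ∫ x : ℝ, Real.exp (1 * x) * Real.exp (-(1 / 2) * Real.exp x) := by
    rw [h1, ← integral_const_mul, ← Real.norm_eq_abs]
    refine norm_integral_le_of_norm_le (integrable_exp_mul_exp_half.const_mul _)
      (Eventually.of_forall fun x => (Complex.abs_im_le_norm _).trans ?_)
    refine (norm_mlKernel_le hρ hρ1 hμ (by rw [im_line]; exact ang_mem)).trans_eq ?_
    rw [norm_exp_exp_add_line, cos_ang]
  rw [abs_mul, abs_of_pos Real.pi_pos] at h2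
  calc μ * |ml ρ μ| * Real.pi = μ * (Real.pi * |ml ρ μ|) := by ring
    _ ≤ μ * (2 / μ * ∫ x : ℝ, Real.exp (1 * x) * Real.exp (-(1 / 2) * Real.exp x)) := by gcongr
    _ = _ := by field_simp

/-- For `μ ≥ 1` this follows from the decay in `μ`; for `μ ≤ 1` the series is dominated termwise by
its absolute values at `μ = 1`. -/
theorem exists_abs_ml_le {ρ : ℝ} (hρ : 0 < ρ) (hρ1 : ρ ≤ 1) :
    ∃ C : ℝ, ∀ μ, 0 < μ → |ml ρ μ| ≤ C := by
  obtain ⟨C, hC⟩ := exists_mul_abs_ml_le hρ hρ1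
  refine ⟨max C (∑' k : ℕ, 1 ^ k / Real.Gamma (ρ * k + ρ)), fun μ hμ => ?_⟩
  have hs := summable_pow_div_Gamma (b := ρ) hρ hρ1 1
  rcases le_total 1 μ with h | h
  · refine le_max_of_le_left (le_trans ?_ (hC μ hμ))
    exact le_mul_of_one_le_left (abs_nonneg _) h
  · refine le_max_of_le_right ?_
    rw [ml, ← Real.norm_eq_abs]
    refine tsum_of_norm_bounded hs.hasSum fun k => ?_
    have hG : 0 < Real.Gamma (ρ * k + ρ) := Real.Gamma_pos_of_pos (by positivity)
    rw [norm_div, norm_pow, norm_neg, Real.norm_of_nonneg hμ.le, Real.norm_of_nonneg hG.le]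
    gcongr

theorem ml_one (μ : ℝ) : ml 1 μ = Real.exp (-μ) := by
  rw [ml, Real.exp_eq_exp_ℝ, NormedSpace.exp_eq_tsum_div]
  refine tsum_congr fun k => ?_
  rw [one_mul, Real.Gamma_nat_eq_factorial]

/-! ### Monotonicity in the order -/

/-- The remainder of the two-term expansion of the integrand at large times, `L = log t`. -/
def remKernel (L lam ρ : ℝ) (w : ℂ) : ℂ :=
  Complex.exp (Complex.exp w + w) *
    (Complex.exp (ρ * (w - L)) ^ 2 / (Complex.exp (ρ * (w - L)) + lam))

/-- The derivative of `remKernel` with respect to the order `ρ`. -/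
def remKernelDeriv (L lam ρ : ℝ) (w : ℂ) : ℂ :=
  Complex.exp (Complex.exp w + w) * ((w - L) * Complex.exp (ρ * (w - L)) ^ 2 *
    (Complex.exp (ρ * (w - L)) + 2 * lam) / (Complex.exp (ρ * (w - L)) + lam) ^ 2)

/-- Orders up to `9/8` are allowed because `(9/8)(2π/3) = 3π/4`. The margin beyond `1` permits
two-sided differentiation at `ρ = 1`. -/
theorem norm_exp_shift_add_ge {L lam ρ x : ℝ} (hρ : 0 < ρ) (hρ1 : ρ ≤ 9 / 8) (hlam : 0 ≤ lam) :
    lam / 2 ≤ ‖Complex.exp (ρ * ((x + ang * Complex.I : ℂ) - L)) + lam‖ := by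
  refine norm_exp_add_ge ?_ hlam
  rw [Complex.im_ofReal_mul]
  simp only [Complex.sub_im, im_line, Complex.ofReal_im, sub_zero]
  rw [abs_of_pos (mul_pos hρ ang_pos), ang]
  nlinarith [Real.pi_pos]

theorem norm_exp_shift_sq {L ρ x : ℝ} :
    ‖Complex.exp (ρ * ((x + ang * Complex.I : ℂ) - L)) ^ 2‖ =
      Real.exp (-(2 * ρ * L)) * Real.exp (2 * ρ * x) := by
  rw [norm_pow, Complex.norm_exp, ← Real.exp_nat_mul, ← Real.exp_add]
  congr 1
  simp
  ring

/-- A majorant of the remainder and of its derivative, independent of the order. -/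
def remMajorant (x : ℝ) : ℝ :=
  (|x| + 3) * ((Real.exp x + Real.exp (13 / 4 * x)) * Real.exp (-(1 / 2) * Real.exp x))

theorem integrable_remMajorant : Integrable remMajorant := by
  have hc : (0 : ℝ) < 1 / 2 := by norm_num
  have h1 := integrable_abs_mul_exp_mul_exp_neg_exp (b := 1) (by norm_num) hc
  have h2 := integrable_abs_mul_exp_mul_exp_neg_exp (b := 13 / 4) (by norm_num) hc
  have h3 := (integrable_exp_mul_exp_neg_exp (b := 1) (by norm_num) hc).const_mul 3
  have h4 := (integrable_exp_mul_exp_neg_exp (b := 13 / 4) (by norm_num) hc).const_mul 3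
  refine ((h1.add h2).add (h3.add h4)).congr (Eventually.of_forall fun x => ?_)
  simp only [Pi.add_apply, remMajorant, one_mul]
  ring

/-- The exponent `13/4 = 1 + 2 * (9/8)` is the largest that occurs and governs `x ≥ 0`; for `x ≤ 0`
the term `exp x` suffices. -/
theorem exp_mul_exp_shift_le {ρ x : ℝ} (hρ : 0 < ρ) (hρ1 : ρ ≤ 9 / 8) :
    Real.exp (1 * x) * Real.exp (2 * ρ * x) ≤ Real.exp x + Real.exp (13 / 4 * x) := by
  rw [← Real.exp_add]
  rcases le_total 0 x with h | h
  · refine le_add_of_nonneg_of_le (Real.exp_pos _).le (Real.exp_le_exp.2 ?_)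
    nlinarith
  · refine le_add_of_le_of_nonneg (Real.exp_le_exp.2 ?_) (Real.exp_pos _).le
    nlinarith

theorem ang_le_three : ang ≤ 3 := by
  unfold ang; linarith [Real.pi_lt_d2]

theorem norm_remKernel_le {L lam ρ x : ℝ} (hL : 0 ≤ L) (hρ : 0 < ρ) (hρ1 : ρ ≤ 9 / 8)
    (hlam : 0 < lam) :
    ‖remKernel L lam ρ (x + ang * Complex.I)‖ ≤ 2 / lam * remMajorant x := by
  have h1 := norm_exp_shift_add_ge (L := L) (x := x) hρ hρ1 hlam.le
  have h2 := exp_mul_exp_shift_le (x := x) hρ hρ1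
  have h3 : Real.exp (-(2 * ρ * L)) ≤ 1 := Real.exp_le_one_iff.2 (by nlinarith)
  rw [remKernel, norm_mul, norm_div, norm_exp_shift_sq, norm_exp_exp_add_line, cos_ang, remMajorant]
  have h4 : (1 : ℝ) ≤ |x| + 3 := by linarith [abs_nonneg x]
  calc _ ≤ Real.exp (1 * x) * Real.exp (-(1 / 2) * Real.exp x) *
        (1 * Real.exp (2 * ρ * x) / (lam / 2)) := by gcongr
    _ = 2 / lam * (1 * ((Real.exp (1 * x) * Real.exp (2 * ρ * x)) *
        Real.exp (-(1 / 2) * Real.exp x))) := by field_simp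
    _ ≤ _ := by gcongr

/-- The factor `exp (-2ρL) = t^(-2ρ)` comes from `q²`, and `1 + L` from differentiating the exponent
`ρ (w - L)`. The first makes this negligible against the leading `t^(-ρ)`. -/
theorem norm_remKernelDeriv_le {L lam ρ x : ℝ} (hL : 0 ≤ L) (hρ : 0 < ρ) (hρ1 : ρ ≤ 9 / 8)
    (hlam : 0 < lam) :
    ‖remKernelDeriv L lam ρ (x + ang * Complex.I)‖ ≤
      Real.exp (-(2 * ρ * L)) * (6 / lam * (1 + L) * remMajorant x) := by
  have h1 := norm_exp_shift_add_ge (L := L) (x := x) hρ hρ1 hlam.le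
  have h2 := exp_mul_exp_shift_le (x := x) hρ hρ1
  set q := Complex.exp (ρ * ((x + ang * Complex.I : ℂ) - L)) with hq
  have hpos : 0 < ‖q + lam‖ := by linarith [half_pos hlam]
  have h5 : ‖q + 2 * lam‖ ≤ 3 * ‖q + lam‖ := by
    have : q + 2 * lam = (q + lam) + lam := by ring
    rw [this]
    refine (norm_add_le _ _).trans ?_
    rw [Complex.norm_real, Real.norm_of_nonneg hlam.le]
    linarith
  have h6 : ‖(x + ang * Complex.I : ℂ) - L‖ ≤ (|x| + 3) * (1 + L) := by
    have h7 : ‖(x + ang * Complex.I : ℂ) - L‖ ≤ |x| + ang + L := by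
      refine (norm_sub_le _ _).trans (add_le_add ((norm_add_le _ _).trans ?_) ?_)
      · simp [abs_of_pos ang_pos]
      · simp [abs_of_nonneg hL]
    have := ang_le_three
    nlinarith [abs_nonneg x, mul_nonneg (abs_nonneg x) hL]
  -- Since `λ ≤ 2‖q + λ‖`, the quotient is at most `3/‖q + λ‖`, hence at most `6/λ`.
  have h8 : ‖q + 2 * lam‖ / ‖q + lam‖ ^ 2 ≤ 6 / lam := by
    rw [div_le_div_iff₀ (by positivity) hlam]
    nlinarith
  rw [remKernelDeriv, ← hq, norm_mul, norm_div, norm_mul, norm_mul, hq, norm_exp_shift_sq, ← hq,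
    norm_exp_exp_add_line, cos_ang, remMajorant, norm_pow]
  calc _ = Real.exp (-(2 * ρ * L)) * ((‖q + 2 * lam‖ / ‖q + lam‖ ^ 2) *
        ‖(x + ang * Complex.I : ℂ) - L‖ * ((Real.exp (1 * x) * Real.exp (2 * ρ * x)) *
        Real.exp (-(1 / 2) * Real.exp x))) := by ring
    _ ≤ Real.exp (-(2 * ρ * L)) * ((6 / lam) * ((|x| + 3) * (1 + L)) *
        ((Real.exp x + Real.exp (13 / 4 * x)) * Real.exp (-(1 / 2) * Real.exp x))) := by gcongr
    _ = _ := by ring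

theorem hasDerivAt_remKernel {L lam ρ x : ℝ} (hρ : 0 < ρ) (hρ1 : ρ ≤ 9 / 8) (hlam : 0 < lam) :
    HasDerivAt (fun ρ : ℝ => remKernel L lam ρ (x + ang * Complex.I))
      (remKernelDeriv L lam ρ (x + ang * Complex.I)) ρ := by
  set w : ℂ := x + ang * Complex.I with hw
  have h1 := norm_exp_shift_add_ge (L := L) (x := x) hρ hρ1 hlam.le
  have hne : Complex.exp (ρ * (w - L)) + lam ≠ 0 := by
    rw [← norm_pos_iff]; linarith [half_pos hlam]
  have hq : HasDerivAt (fun ρ : ℝ => Complex.exp (ρ * (w - L)))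
      (Complex.exp (ρ * (w - L)) * (w - L)) ρ := by
    have := (Complex.ofRealCLM.hasDerivAt (x := ρ)).mul_const (w - (L : ℂ))
    simpa using this.cexp
  have h2 := ((hq.pow 2).div (hq.add_const (lam : ℂ)) hne).const_mul
    (Complex.exp (Complex.exp w + w))
  refine h2.congr_deriv ?_
  rw [remKernelDeriv]
  congr 2
  simp
  ring

theorem continuous_remKernel {L lam ρ : ℝ} (hρ : 0 < ρ) (hρ1 : ρ ≤ 9 / 8) (hlam : 0 < lam) :
    Continuous fun x : ℝ => remKernel L lam ρ (x + ang * Complex.I) := by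
  have hne : ∀ x : ℝ, Complex.exp (ρ * ((x + ang * Complex.I : ℂ) - L)) + lam ≠ 0 := fun x => by
    have h1 := norm_exp_shift_add_ge (L := L) (x := x) hρ hρ1 hlam.le
    rw [← norm_pos_iff]; linarith [half_pos hlam]
  unfold remKernel
  fun_prop (disch := assumption)

theorem continuous_remKernelDeriv {L lam ρ : ℝ} (hρ : 0 < ρ) (hρ1 : ρ ≤ 9 / 8) (hlam : 0 < lam) :
    Continuous fun x : ℝ => remKernelDeriv L lam ρ (x + ang * Complex.I) := by
  have hne : ∀ x : ℝ, (Complex.exp (ρ * ((x + ang * Complex.I : ℂ) - L)) + lam) ^ 2 ≠ 0 :=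
    fun x => by
      have h1 := norm_exp_shift_add_ge (L := L) (x := x) hρ hρ1 hlam.le
      refine pow_ne_zero _ ?_
      rw [← norm_pos_iff]; linarith [half_pos hlam]
  unfold remKernelDeriv
  fun_prop (disch := assumption)

theorem integrable_remKernel {L lam ρ : ℝ} (hL : 0 ≤ L) (hρ : 0 < ρ) (hρ1 : ρ ≤ 9 / 8)
    (hlam : 0 < lam) : Integrable fun x : ℝ => remKernel L lam ρ (x + ang * Complex.I) :=
  (integrable_remMajorant.const_mul (2 / lam)).mono'
    (continuous_remKernel hρ hρ1 hlam).aestronglyMeasurable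
    (Eventually.of_forall fun _ => norm_remKernel_le hL hρ hρ1 hlam)

theorem hasDerivAt_integral_remKernel {L lam ρ : ℝ} (hL : 0 ≤ L) (hρ : 0 < ρ) (hρ1 : ρ < 9 / 8)
    (hlam : 0 < lam) :
    HasDerivAt (fun ρ : ℝ => ∫ x : ℝ, remKernel L lam ρ (x + ang * Complex.I))
      (∫ x : ℝ, remKernelDeriv L lam ρ (x + ang * Complex.I)) ρ := by
  have hmem : Ioo (0 : ℝ) (9 / 8) ∈ 𝓝 ρ := Ioo_mem_nhds hρ hρ1
  refine (hasDerivAt_integral_of_dominated_loc_of_deriv_le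
    (F' := fun ρ (x : ℝ) => remKernelDeriv L lam ρ (x + ang * Complex.I))
    (bound := fun x => 6 / lam * (1 + L) * remMajorant x) hmem ?_
    (integrable_remKernel hL hρ hρ1.le hlam)
    (continuous_remKernelDeriv hρ hρ1.le hlam).aestronglyMeasurable ?_
    (integrable_remMajorant.const_mul _) ?_).2
  · filter_upwards [hmem] with r hr
    exact (continuous_remKernel hr.1 hr.2.le hlam).aestronglyMeasurable
  · refine Eventually.of_forall fun x r hr => (norm_remKernelDeriv_le hL hr.1 hr.2.le hlam).trans ?_
    refine mul_le_of_le_one_left ?_ (Real.exp_le_one_iff.2 (by nlinarith [mul_nonneg hr.1.le hL]))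
    have : 0 ≤ remMajorant x := by unfold remMajorant; positivity
    positivity
  · exact Eventually.of_forall fun x r hr => hasDerivAt_remKernel hr.1 hr.2.le hlam

/-- `π λ² t` times the scalar solution `t ^ (ρ - 1) * E_{ρ,ρ}(-λ t ^ ρ)`, at `t = exp L`. -/
def scaledSol (L lam ρ : ℝ) : ℝ :=
  Real.sin (Real.pi * ρ) * Real.Gamma (1 + ρ) * Real.exp (-(ρ * L)) +
    (∫ x : ℝ, remKernel L lam ρ (x + ang * Complex.I)).im

theorem integral_gammaKernel_im {s : ℝ} (hs : s < 1) :
    (∫ x : ℝ, gammaKernel s (x + ang * Complex.I)).im =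
      Real.sin (Real.pi * (1 - s)) * Real.Gamma (1 - s) := by
  rw [integral_gammaKernel_upper hs, Complex.im_mul_ofReal, ← Complex.ofReal_mul,
    Complex.exp_ofReal_mul_I_im]

/-- With `d = t^(-ρ)` and `q = (z/t)^ρ`, the denominator is `(q + λ)/d`, and the identity is
`1/(q+λ) = 1/λ - q/λ² + q²/(λ²(q+λ))`. -/
theorem mlKernel_eq {L lam ρ x : ℝ} (hρ : 0 < ρ) (hρ1 : ρ ≤ 1) (hlam : 0 < lam) :
    mlKernel ρ (lam * Real.exp L ^ ρ) (x + ang * Complex.I) =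
      Real.exp (-(ρ * L)) / lam * gammaKernel 0 (x + ang * Complex.I) -
      Real.exp (-(ρ * L)) ^ 2 / lam ^ 2 * gammaKernel (-ρ) (x + ang * Complex.I) +
      Real.exp (-(ρ * L)) / lam ^ 2 * remKernel L lam ρ (x + ang * Complex.I) := by
  set w : ℂ := x + ang * Complex.I with hw
  have h1 := norm_exp_shift_add_ge (L := L) (x := x) hρ (by linarith) hlam.le
  set E := Complex.exp (Complex.exp w + w) with hE
  set q := Complex.exp (ρ * (w - L)) with hq
  have hne : q + lam ≠ 0 := by
    rw [← norm_pos_iff]; linarith [half_pos hlam]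
  set d : ℂ := (Real.exp (-(ρ * L)) : ℂ) with hd
  have hd' : d = Complex.exp (-(ρ * L)) := by rw [hd]; push_cast; rfl
  have hg0 : gammaKernel 0 w = E := by rw [gammaKernel, hE]; simp
  have hd0 : d ≠ 0 := by rw [hd']; exact Complex.exp_ne_zero _
  have hg1 : d * gammaKernel (-ρ) w = E * q := by
    rw [gammaKernel, hE, hq, hd', ← Complex.exp_add, ← Complex.exp_add]
    congr 1
    push_cast
    ring
  have hden : Complex.exp (ρ * w) + (lam * Real.exp L ^ ρ : ℝ) = (q + lam) / d := by
    rw [eq_div_iff hd0, add_mul]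
    congr 1
    · rw [hq, hd', ← Complex.exp_add]
      congr 1
      ring
    · rw [hd, ← Complex.ofReal_mul, mul_assoc, ← Real.exp_mul, ← Real.exp_add]
      simp [mul_comm]
  have hl : (lam : ℂ) ≠ 0 := by simpa using hlam.ne'
  have hg2 : d ^ 2 / lam ^ 2 * gammaKernel (-ρ) w = d / lam ^ 2 * (E * q) := by
    rw [← hg1]; ring
  rw [mlKernel, hden, hg0, remKernel, ← hE, ← hq, hg2]
  field_simp
  ring

/-- The `1/λ` term contributes `sin π * Γ(1) = 0`. The next one contributes `sin(πρ) Γ(1+ρ)`, by the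
sign in `sin(π + πρ)`. -/
theorem scaledSol_eq {L lam ρ : ℝ} (hL : 0 ≤ L) (hρ : 0 < ρ) (hρ1 : ρ ≤ 1) (hlam : 0 < lam) :
    scaledSol L lam ρ = Real.pi * lam ^ 2 * Real.exp (ρ * L) * ml ρ (lam * Real.exp L ^ ρ) := by
  have hμ : 0 < lam * Real.exp L ^ ρ := by positivity
  have h1 := pi_mul_ml hρ hρ1 hμ
  have h2 : ∫ x : ℝ, (mlKernel ρ (lam * Real.exp L ^ ρ) (x + ang * Complex.I)).im =
      (∫ x : ℝ, mlKernel ρ (lam * Real.exp L ^ ρ) (x + ang * Complex.I)).im :=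
    integral_im (𝕜 := ℂ) (integrable_mlKernel hρ hρ1 hμ ang_mem cos_ang)
  have h3 := (integrable_gammaKernel (s := 0) (by norm_num)).const_mul
    ((Real.exp (-(ρ * L)) : ℂ) / lam)
  have h4 := (integrable_gammaKernel (s := -ρ) (by linarith)).const_mul
    ((Real.exp (-(ρ * L)) : ℂ) ^ 2 / lam ^ 2)
  have h5 := (integrable_remKernel hL hρ (by linarith) hlam).const_mul
    ((Real.exp (-(ρ * L)) : ℂ) / lam ^ 2)
  have h6 : ∫ x : ℝ, mlKernel ρ (lam * Real.exp L ^ ρ) (x + ang * Complex.I) =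
      (Real.exp (-(ρ * L)) : ℂ) / lam * (∫ x : ℝ, gammaKernel 0 (x + ang * Complex.I)) -
      (Real.exp (-(ρ * L)) : ℂ) ^ 2 / lam ^ 2 *
        (∫ x : ℝ, gammaKernel (-ρ) (x + ang * Complex.I)) +
      (Real.exp (-(ρ * L)) : ℂ) / lam ^ 2 * ∫ x : ℝ, remKernel L lam ρ (x + ang * Complex.I) := by
    simp_rw [mlKernel_eq hρ hρ1 hlam]
    rw [← integral_const_mul, ← integral_const_mul, ← integral_const_mul]
    rw [← integral_sub h3 h4]
    exact integral_add (h3.sub h4) h5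
  have hI0 := integral_gammaKernel_im (s := 0) (by norm_num)
  have hI1 := integral_gammaKernel_im (s := -ρ) (by linarith)
  simp only [sub_zero, mul_one, Real.sin_pi, zero_mul] at hI0
  rw [sub_neg_eq_add, mul_add, mul_one, add_comm Real.pi, Real.sin_add_pi] at hI1
  rw [h2, h6] at h1
  have e1 : (Real.exp (-(ρ * L)) : ℂ) / lam = ((Real.exp (-(ρ * L)) / lam : ℝ) : ℂ) := by
    push_cast; rfl
  have e2 : (Real.exp (-(ρ * L)) : ℂ) ^ 2 / lam ^ 2 =
      ((Real.exp (-(ρ * L)) ^ 2 / lam ^ 2 : ℝ) : ℂ) := by push_cast; rfl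
  have e3 : (Real.exp (-(ρ * L)) : ℂ) / lam ^ 2 = ((Real.exp (-(ρ * L)) / lam ^ 2 : ℝ) : ℂ) := by
    push_cast; rfl
  rw [e1, e2, e3, Complex.add_im, Complex.sub_im, Complex.im_ofReal_mul, Complex.im_ofReal_mul,
    Complex.im_ofReal_mul, hI0, hI1] at h1
  have hexp : Real.exp (ρ * L) = (Real.exp (-(ρ * L)))⁻¹ := by rw [Real.exp_neg, inv_inv]
  have hd := Real.exp_pos (-(ρ * L))
  rw [mul_assoc, mul_assoc, mul_left_comm _ _ (ml _ _), mul_left_comm Real.pi,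
    mul_left_comm Real.pi, h1, hexp, scaledSol]
  field_simp
  ring

theorem hasDerivAt_scaledSol {L lam ρ : ℝ} (hL : 0 ≤ L) (hρ : 0 < ρ) (hρ1 : ρ < 9 / 8)
    (hlam : 0 < lam) :
    HasDerivAt (scaledSol L lam)
      (Real.exp (-(ρ * L)) * (Real.pi * Real.cos (Real.pi * ρ) * Real.Gamma (1 + ρ) +
        Real.sin (Real.pi * ρ) * (deriv Real.Gamma (1 + ρ) - L * Real.Gamma (1 + ρ))) +
      (∫ x : ℝ, remKernelDeriv L lam ρ (x + ang * Complex.I)).im) ρ := by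
  have h1 : HasDerivAt (fun ρ : ℝ => Real.sin (Real.pi * ρ))
      (Real.cos (Real.pi * ρ) * Real.pi) ρ := by
    simpa using ((hasDerivAt_id ρ).const_mul Real.pi).sin
  have h2 : HasDerivAt (fun ρ : ℝ => Real.Gamma (1 + ρ)) (deriv Real.Gamma (1 + ρ)) ρ := by
    have : DifferentiableAt ℝ Real.Gamma (1 + ρ) := Real.differentiableAt_Gamma fun m => by
      have : (0 : ℝ) ≤ m := m.cast_nonneg
      linarith
    exact this.hasDerivAt.comp_const_add 1 ρ
  have h3 : HasDerivAt (fun ρ : ℝ => Real.exp (-(ρ * L))) (Real.exp (-(ρ * L)) * -L) ρ := by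
    simpa using ((hasDerivAt_id ρ).mul_const L).neg.exp
  have h4 := (hasDerivAt_integral_remKernel hL hρ hρ1 hlam)
  have h5 : HasDerivAt (fun ρ : ℝ => (∫ x : ℝ, remKernel L lam ρ (x + ang * Complex.I)).im)
      (∫ x : ℝ, remKernelDeriv L lam ρ (x + ang * Complex.I)).im ρ :=
    Complex.imCLM.hasFDerivAt.comp_hasDerivAt ρ h4
  refine (((h1.mul h2).mul h3).add h5).congr_deriv ?_
  simp only [Pi.mul_apply]
  ring

/-! ### Gamma estimates and the sign of the leading term -/

theorem deriv_Gamma_le_two {ρ : ℝ} (hρ : 0 < ρ) (hρ1 : ρ < 1) : deriv Real.Gamma (1 + ρ) ≤ 2 := by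
  have h1 : DifferentiableAt ℝ Real.Gamma (1 + ρ) := Real.differentiableAt_Gamma fun m => by
    have : (0 : ℝ) ≤ m := m.cast_nonneg
    linarith
  -- By convexity the derivative is at most the slope of the chord ending at `3`, which has length
  -- greater than `1` and where `Γ(3) = 2`.
  have h2 := Real.convexOn_Gamma.deriv_le_slope (x := 1 + ρ) (y := 3) (by simp; linarith)
    (by simp) (by linarith) h1
  refine h2.trans ?_
  have h3 : Real.Gamma 3 = 2 := by
    rw [show (3 : ℝ) = 2 + 1 by norm_num, Real.Gamma_add_one two_ne_zero, Real.Gamma_two, mul_one]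
  have h4 : 0 < Real.Gamma (1 + ρ) := Real.Gamma_pos_of_pos (by linarith)
  rw [slope_def_field, h3, div_le_iff₀ (by linarith)]
  linarith

theorem exists_Gamma_ge : ∃ γ : ℝ, 0 < γ ∧ ∀ x, 0 < x → γ ≤ Real.Gamma x := by
  obtain ⟨x, hx, hmin⟩ := Real.exists_isMinOn_Gamma_Ioi
  exact ⟨Real.Gamma x, Real.Gamma_pos_of_pos (by linarith [hx.1]), fun y hy => hmin hy⟩

theorem Gamma_one_add_le_one {ρ : ℝ} (hρ : 0 < ρ) (hρ1 : ρ < 1) : Real.Gamma (1 + ρ) ≤ 1 := by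
  have h := Real.convexOn_Gamma.2 (mem_Ioi.2 (one_pos : (0 : ℝ) < 1))
    (mem_Ioi.2 (two_pos : (0 : ℝ) < 2)) (sub_nonneg.2 hρ1.le) hρ.le (by ring)
  simp only [smul_eq_mul, Real.Gamma_one, Real.Gamma_two] at h
  rw [show (1 - ρ) * 1 + ρ * 2 = 1 + ρ by ring] at h
  linarith

theorem sin_pi_mul_ge {ρ₀ ρ : ℝ} (hρ₀ : 0 < ρ₀) (h : ρ₀ ≤ ρ) (hρ : ρ ≤ 3 / 4) :
    min ρ₀ (1 / 2) ≤ Real.sin (Real.pi * ρ) := by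
  have hpi := Real.pi_pos
  rcases le_total ρ (1 / 2) with h1 | h1
  · have h2 := Real.mul_le_sin (x := Real.pi * ρ) (by nlinarith) (by nlinarith)
    have h3 : 2 / Real.pi * (Real.pi * ρ) = 2 * ρ := by field_simp
    refine (min_le_left _ _).trans ?_
    linarith
  · have h2 := Real.mul_le_sin (x := Real.pi * (1 - ρ)) (by nlinarith) (by nlinarith)
    have h3 : 2 / Real.pi * (Real.pi * (1 - ρ)) = 2 * (1 - ρ) := by field_simp
    rw [mul_sub, mul_one, Real.sin_pi_sub] at h2
    refine (min_le_right _ _).trans ?_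
    rw [mul_sub, mul_one] at h3
    linarith

/-- Two regimes: for `ρ ≤ 3/4` the sine is bounded below, so a large `L` forces negativity; for `ρ ≥
3/4` the sine term is nonpositive and `cos(πρ) ≤ -1/2` supplies the bound, also as `ρ → 1`. -/
theorem exists_leading_coeff_le {ρ₀ : ℝ} (hρ₀ : 0 < ρ₀) :
    ∃ c L₀ : ℝ, 0 < c ∧ ∀ L ≥ L₀, ∀ ρ, ρ₀ ≤ ρ → ρ < 1 →
      Real.pi * Real.cos (Real.pi * ρ) * Real.Gamma (1 + ρ) +
        Real.sin (Real.pi * ρ) * (deriv Real.Gamma (1 + ρ) - L * Real.Gamma (1 + ρ)) ≤ -c := by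
  obtain ⟨γ, hγ, hγle⟩ := exists_Gamma_ge
  have hpi := Real.pi_pos
  have hpi3 := Real.pi_gt_three
  set s := min ρ₀ (1 / 2) with hs
  have hs0 : 0 < s := lt_min hρ₀ (by norm_num)
  -- The threshold on `L` makes the bracket multiplying the sine at most `-(π+1)/s`, so that after
  -- multiplication by `sin(πρ) ≥ s` it outweighs the cosine term, which is at most `π`, by `1`.
  refine ⟨min 1 γ, (2 + (Real.pi + 1) / s) / γ, lt_min one_pos hγ, fun L hL ρ h0 h1 => ?_⟩
  have hρ : 0 < ρ := hρ₀.trans_le h0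
  have hG := hγle (1 + ρ) (by linarith)
  have hG1 := Gamma_one_add_le_one hρ h1
  have hD := deriv_Gamma_le_two hρ h1
  have hsin : 0 ≤ Real.sin (Real.pi * ρ) :=
    Real.sin_nonneg_of_nonneg_of_le_pi (by positivity) (by nlinarith)
  rw [ge_iff_le, div_le_iff₀ hγ] at hL
  have hps : 0 < (Real.pi + 1) / s := by positivity
  have hL0 : 0 ≤ L := by
    by_contra hneg
    nlinarith
  have hLG : L * γ ≤ L * Real.Gamma (1 + ρ) := by gcongr
  have hbr : deriv Real.Gamma (1 + ρ) - L * Real.Gamma (1 + ρ) ≤ -((Real.pi + 1) / s) := by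
    linarith
  rcases le_total ρ (3 / 4) with h | h
  · have h2 := sin_pi_mul_ge hρ₀ h0 h
    have h3 : Real.sin (Real.pi * ρ) * (deriv Real.Gamma (1 + ρ) - L * Real.Gamma (1 + ρ)) ≤
        -(Real.pi + 1) := by
      calc _ ≤ Real.sin (Real.pi * ρ) * -((Real.pi + 1) / s) := by gcongr
        _ ≤ s * -((Real.pi + 1) / s) := by
          rw [mul_neg, mul_neg, neg_le_neg_iff]; gcongr
        _ = _ := by field_simp
    have h4 : Real.pi * Real.cos (Real.pi * ρ) * Real.Gamma (1 + ρ) ≤ Real.pi * 1 * 1 := by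
      have := Real.cos_le_one (Real.pi * ρ)
      gcongr
    have := min_le_left 1 γ
    linarith
  · have h2 : Real.sin (Real.pi * ρ) * (deriv Real.Gamma (1 + ρ) - L * Real.Gamma (1 + ρ)) ≤ 0 :=
      mul_nonpos_of_nonneg_of_nonpos hsin (by linarith)
    have h3 : Real.cos (Real.pi * ρ) ≤ -(1 / 2) := by
      rw [← cos_ang]
      refine Real.cos_le_cos_of_nonneg_of_le_pi ang_pos.le (by nlinarith) ?_
      unfold ang
      nlinarith
    have h4 : Real.pi * Real.cos (Real.pi * ρ) * Real.Gamma (1 + ρ) ≤ -γ := by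
      have : Real.pi * Real.cos (Real.pi * ρ) ≤ -1 := by nlinarith
      nlinarith
    have := min_le_right 1 γ
    linarith

theorem abs_im_integral_remKernelDeriv_le {L lam ρ : ℝ} (hL : 0 ≤ L) (hρ : 0 < ρ) (hρ1 : ρ ≤ 9 / 8)
    (hlam : 0 < lam) :
    |(∫ x : ℝ, remKernelDeriv L lam ρ (x + ang * Complex.I)).im| ≤
      Real.exp (-(2 * ρ * L)) * (6 / lam * (1 + L) * ∫ x : ℝ, remMajorant x) := by
  refine (Complex.abs_im_le_norm _).trans ?_
  rw [← integral_const_mul, ← integral_const_mul]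
  exact norm_integral_le_of_norm_le ((integrable_remMajorant.const_mul _).const_mul _)
    (Eventually.of_forall fun x => norm_remKernelDeriv_le hL hρ hρ1 hlam)

/-- At large times, `scaledSol` is strictly decreasing in the order on `[ρ₀, 1]`. -/
theorem exists_strictAntiOn_scaledSol {ρ₀ lam₁ : ℝ} (hρ₀ : 0 < ρ₀) (hlam₁ : 0 < lam₁) :
    ∃ L₀ : ℝ, 0 ≤ L₀ ∧ ∀ L ≥ L₀, ∀ lam ≥ lam₁,
      StrictAntiOn (scaledSol L lam) (Icc ρ₀ 1) ∧ ContinuousOn (scaledSol L lam) (Icc ρ₀ 1) := by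
  obtain ⟨c, L₁, hc, hlead⟩ := exists_leading_coeff_le hρ₀
  set M := ∫ x : ℝ, remMajorant x with hM
  have hM0 : 0 ≤ M := integral_nonneg fun x => by unfold remMajorant; positivity
  -- Of the factor `exp (-2ρL)`, one half matches the leading term and the other is at most `exp
  -- (-ρ₀L)`. This and `1/λ ≤ 1/λ₁` make the threshold depend on `ρ₀` and `λ₁` only.
  have hlim : Tendsto (fun L : ℝ => 6 / lam₁ * M * ((1 + L) * Real.exp (-(ρ₀ * L)))) atTop
      (𝓝 0) := by
    have h1 := tendsto_rpow_mul_exp_neg_mul_atTop_nhds_zero 1 ρ₀ hρ₀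
    have h2 := tendsto_rpow_mul_exp_neg_mul_atTop_nhds_zero 0 ρ₀ hρ₀
    have h3 := (h2.add h1).const_mul (6 / lam₁ * M)
    simp only [add_zero, mul_zero] at h3
    refine h3.congr fun L => ?_
    rw [Real.rpow_zero, Real.rpow_one, neg_mul]
    ring
  obtain ⟨L₂, hL₂⟩ := eventually_atTop.1 (hlim.eventually_lt_const hc)
  refine ⟨max 0 (max L₁ L₂), le_max_left _ _, fun L hL lam hlam => ?_⟩
  have hL0 : 0 ≤ L := (le_max_left _ _).trans hL
  have hLL₁ : L₁ ≤ L := (le_max_left _ _).trans ((le_max_right _ _).trans hL)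
  have hLL₂ : L₂ ≤ L := (le_max_right _ _).trans ((le_max_right _ _).trans hL)
  have hlam0 : 0 < lam := hlam₁.trans_le hlam
  have hcont : ContinuousOn (scaledSol L lam) (Icc ρ₀ 1) := fun ρ hρ =>
    (hasDerivAt_scaledSol hL0 (hρ₀.trans_le hρ.1) (by linarith [hρ.2])
      hlam0).continuousAt.continuousWithinAt
  refine ⟨strictAntiOn_of_deriv_neg (convex_Icc _ _) hcont fun ρ hρ => ?_, hcont⟩
  rw [interior_Icc] at hρ
  have hρ0 : 0 < ρ := hρ₀.trans hρ.1
  rw [(hasDerivAt_scaledSol hL0 hρ0 (by linarith [hρ.2]) hlam0).deriv]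
  have h1 := hlead L hLL₁ ρ hρ.1.le hρ.2
  have h2 := (le_abs_self _).trans
    (abs_im_integral_remKernelDeriv_le (L := L) (lam := lam) hL0 hρ0 (by linarith [hρ.2]) hlam0)
  have h3 := hL₂ L hLL₂
  have hE := Real.exp_pos (-(ρ * L))
  have h4 : Real.exp (-(2 * ρ * L)) * (6 / lam * (1 + L) * M) ≤
      Real.exp (-(ρ * L)) * (6 / lam₁ * M * ((1 + L) * Real.exp (-(ρ₀ * L)))) := by
    have e1 : Real.exp (-(2 * ρ * L)) = Real.exp (-(ρ * L)) * Real.exp (-(ρ * L)) := by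
      rw [← Real.exp_add]; congr 1; ring
    have e2 : Real.exp (-(ρ * L)) ≤ Real.exp (-(ρ₀ * L)) := by
      have := hρ.1.le
      gcongr
    calc _ = Real.exp (-(ρ * L)) * (6 / lam * M * ((1 + L) * Real.exp (-(ρ * L)))) := by
          rw [e1]; ring
      _ ≤ _ := by gcongr
  have h5 : Real.exp (-(ρ * L)) * (Real.pi * Real.cos (Real.pi * ρ) * Real.Gamma (1 + ρ) +
      Real.sin (Real.pi * ρ) * (deriv Real.Gamma (1 + ρ) - L * Real.Gamma (1 + ρ))) ≤
      Real.exp (-(ρ * L)) * -c := by gcongr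
  have h6 : Real.exp (-(ρ * L)) * (6 / lam₁ * M * ((1 + L) * Real.exp (-(ρ₀ * L)))) <
      Real.exp (-(ρ * L)) * c := by gcongr
  linarith

/-- The solution `t ^ (ρ - 1) * E_{ρ,ρ}(-λ t ^ ρ)` of the scalar problem with initial value `1`. -/
def scalarSol (ρ lam t : ℝ) : ℝ := t ^ (ρ - 1) * ml ρ (lam * t ^ ρ)

/-- The factor `π λ² t` between `scaledSol` and `scalarSol` is positive and free of `ρ`, so
monotonicity transfers, with `T₀ = exp L₀`. -/
theorem exists_strictAntiOn_scalarSol {ρ₀ lam₁ : ℝ} (hρ₀ : 0 < ρ₀) (hlam₁ : 0 < lam₁) :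
    ∃ T₀ : ℝ, 0 < T₀ ∧ ∀ t ≥ T₀, ∀ lam ≥ lam₁,
      StrictAntiOn (fun ρ => scalarSol ρ lam t) (Icc ρ₀ 1) ∧
      ContinuousOn (fun ρ => scalarSol ρ lam t) (Icc ρ₀ 1) := by
  obtain ⟨L₀, hL₀, h⟩ := exists_strictAntiOn_scaledSol hρ₀ hlam₁
  refine ⟨Real.exp L₀, Real.exp_pos _, fun t ht lam hlam => ?_⟩
  have ht0 : 0 < t := (Real.exp_pos _).trans_le ht
  have hL : L₀ ≤ Real.log t := (Real.le_log_iff_exp_le ht0).2 ht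
  have hlam0 : 0 < lam := hlam₁.trans_le hlam
  have heq : EqOn (fun ρ => scalarSol ρ lam t)
      (fun ρ => (Real.pi * lam ^ 2 * t)⁻¹ * scaledSol (Real.log t) lam ρ) (Icc ρ₀ 1) := by
    intro ρ hρ
    simp only
    rw [scaledSol_eq (hL₀.trans hL) (hρ₀.trans_le hρ.1) hρ.2 hlam0, Real.exp_log ht0, scalarSol,
      Real.rpow_sub_one ht0.ne', mul_comm ρ, ← Real.rpow_def_of_pos ht0]
    field_simp
  obtain ⟨h1, h2⟩ := h _ hL _ hlam
  refine ⟨fun a ha b hb hab => ?_, (h2.const_smul (Real.pi * lam ^ 2 * t)⁻¹).congr heq⟩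
  rw [heq ha, heq hb]
  exact mul_lt_mul_of_pos_left (h1 ha hb hab) (by positivity)

/-! ### Fractional integrals of the scalar solution -/

theorem integral_sub_rpow_mul_rpow {α β t : ℝ} (hα : 0 < α) (hβ : 0 < β) (ht : 0 < t) :
    ∫ s in (0 : ℝ)..t, (t - s) ^ (α - 1) * s ^ (β - 1) =
      t ^ (α + β - 1) * (Real.Gamma α * Real.Gamma β / Real.Gamma (α + β)) := by
  have h1 := Complex.betaIntegral_scaled β α ht
  have h2 := Complex.Gamma_mul_Gamma_eq_betaIntegral (s := β) (t := α) (by simpa) (by simpa)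
  have hG : Real.Gamma (α + β) ≠ 0 := (Real.Gamma_pos_of_pos (by linarith)).ne'
  have h3 : Complex.betaIntegral β α =
      ((Real.Gamma α * Real.Gamma β / Real.Gamma (α + β) : ℝ) : ℂ) := by
    rw [← Complex.ofReal_add, Complex.Gamma_ofReal, Complex.Gamma_ofReal, Complex.Gamma_ofReal,
      add_comm β α] at h2
    have hG' : (Real.Gamma (α + β) : ℂ) ≠ 0 := by simpa using hG
    push_cast
    field_simp
    rw [mul_comm (Real.Gamma α : ℂ), h2]
    ring
  apply Complex.ofReal_injective
  rw [← intervalIntegral.integral_ofReal, Complex.ofReal_mul, ← h3, Complex.ofReal_cpow ht.le]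
  have h4 : ((α + β - 1 : ℝ) : ℂ) = β + α - 1 := by push_cast; ring
  rw [h4, ← h1]
  refine intervalIntegral.integral_congr fun s hs => ?_
  rw [uIcc_of_le ht.le] at hs
  rw [Complex.ofReal_mul, Complex.ofReal_cpow (sub_nonneg.2 hs.2), Complex.ofReal_cpow hs.1]
  push_cast
  ring

theorem intervalIntegrable_sub_rpow_mul_rpow {α β t : ℝ} (hα : 0 < α) (hβ : 0 < β) (ht : 0 < t) :
    IntervalIntegrable (fun s : ℝ => (t - s) ^ (α - 1) * s ^ (β - 1)) volume 0 t := by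
  -- A non-integrable function has integral `0` by convention, so the nonzero Beta value already
  -- forces integrability.
  refine intervalIntegral.intervalIntegrable_of_integral_ne_zero ?_
  rw [integral_sub_rpow_mul_rpow hα hβ ht]
  have h1 := Real.Gamma_pos_of_pos hα
  have h2 := Real.Gamma_pos_of_pos hβ
  have h3 := Real.Gamma_pos_of_pos (add_pos hα hβ)
  positivity

theorem hasSum_ml {ρ : ℝ} (hρ : 0 < ρ) (hρ1 : ρ ≤ 1) (μ : ℝ) :
    HasSum (fun k : ℕ => (-μ) ^ k / Real.Gamma (ρ * k + ρ)) (ml ρ μ) :=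
  (summable_pow_div_Gamma hρ hρ1 _).hasSum

theorem rpow_mul_pow_eq {ρ t : ℝ} (lam b : ℝ) (ht : 0 < t) (k : ℕ) :
    t ^ b * (-(lam * t ^ ρ)) ^ k = (-lam) ^ k * t ^ (ρ * k + b) := by
  rw [Real.rpow_add ht, Real.rpow_mul ht.le, Real.rpow_natCast, ← neg_mul, mul_pow]
  ring

theorem hasSum_scalarSol {ρ lam t : ℝ} (hρ : 0 < ρ) (hρ1 : ρ ≤ 1) (ht : 0 < t) :
    HasSum (fun k : ℕ => (-lam) ^ k * t ^ (ρ * k + (ρ - 1)) / Real.Gamma (ρ * k + ρ))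
      (scalarSol ρ lam t) := by
  refine ((hasSum_ml hρ hρ1 (lam * t ^ ρ)).mul_left (t ^ (ρ - 1))).congr_fun ?_
  intro k
  rw [← rpow_mul_pow_eq _ _ ht, mul_div_assoc]

theorem rlIntegral_of_pos {E : Type*} [NormedAddCommGroup E] [NormedSpace ℝ E] {α : ℝ}
    (hα : 0 < α) (h : ℝ → E) (t : ℝ) : rlIntegral α h t =
      (1 / Real.Gamma α) • ∫ ξ in (0 : ℝ)..t, (t - ξ) ^ (α - 1) • h ξ := by
  rw [rlIntegral, if_neg hα.ne']

theorem rlIntegral_zero {E : Type*} [NormedAddCommGroup E] [NormedSpace ℝ E]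
    (h : ℝ → E) (t : ℝ) : rlIntegral 0 h t = h t := by
  rw [rlIntegral, if_pos rfl]

/-- Term-by-term fractional integration of the scalar solution. -/
theorem hasSum_rlIntegral_scalarSol {ρ lam t α : ℝ} (hρ : 0 < ρ) (hρ1 : ρ ≤ 1) (hα : 0 ≤ α)
    (ht : 0 < t) :
    HasSum (fun k : ℕ => (-lam) ^ k * t ^ (ρ * k + (ρ + α - 1)) / Real.Gamma (ρ * k + (ρ + α)))
      (rlIntegral α (scalarSol ρ lam) t) := by
  rcases hα.eq_or_lt with rfl | hα
  · simpa [rlIntegral_zero] using hasSum_scalarSol (lam := lam) hρ hρ1 ht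
  have hb : ∀ k : ℕ, 0 < ρ * k + ρ := fun k => by positivity
  set F : ℕ → ℝ → ℝ := fun k s => (-lam) ^ k / Real.Gamma (ρ * k + ρ) *
    ((t - s) ^ (α - 1) * s ^ (ρ * k + ρ - 1)) with hF
  have hint : ∀ k, Integrable (F k) (volume.restrict (Ioc 0 t)) := fun k =>
    (((intervalIntegrable_iff_integrableOn_Ioc_of_le ht.le).1
      (intervalIntegrable_sub_rpow_mul_rpow hα (hb k) ht)).const_mul _)
  have hval : ∀ k : ℕ, ∫ s in Ioc 0 t, (t - s) ^ (α - 1) * s ^ (ρ * k + ρ - 1) =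
      t ^ (ρ * k + (ρ + α - 1)) *
        (Real.Gamma α * Real.Gamma (ρ * k + ρ) / Real.Gamma (ρ * k + (ρ + α))) := fun k => by
    rw [← intervalIntegral.integral_of_le ht.le, integral_sub_rpow_mul_rpow hα (hb k) ht,
      show α + (ρ * k + ρ) - 1 = ρ * k + (ρ + α - 1) by ring,
      show α + (ρ * k + ρ) = ρ * k + (ρ + α) by ring]
  have hGα := Real.Gamma_pos_of_pos hα
  have hGk : ∀ k : ℕ, 0 < Real.Gamma (ρ * k + ρ) := fun k => Real.Gamma_pos_of_pos (hb k)
  have hGk' : ∀ k : ℕ, 0 < Real.Gamma (ρ * k + (ρ + α)) := fun k =>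
    Real.Gamma_pos_of_pos (by have := hb k; linarith)
  have hnorm : ∀ k, ∫ s in Ioc 0 t, ‖F k s‖ = Real.Gamma α * t ^ (ρ + α - 1) *
      ((|lam| * t ^ ρ) ^ k / Real.Gamma (ρ * k + (ρ + α))) := fun k => by
    have h1 : ∫ s in Ioc 0 t, ‖F k s‖ = ∫ s in Ioc 0 t, |lam| ^ k / Real.Gamma (ρ * k + ρ) *
        ((t - s) ^ (α - 1) * s ^ (ρ * k + ρ - 1)) := by
      refine setIntegral_congr_fun measurableSet_Ioc fun s hs => ?_
      have hts : 0 ≤ t - s := sub_nonneg.2 hs.2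
      have hs0 : 0 ≤ s := hs.1.le
      simp only [hF]
      rw [norm_mul, norm_div, norm_pow, norm_neg, Real.norm_eq_abs,
        Real.norm_of_nonneg (hGk k).le, Real.norm_of_nonneg (by positivity)]
    have h2 : t ^ (ρ * k + (ρ + α - 1)) = (t ^ ρ) ^ k * t ^ (ρ + α - 1) := by
      rw [Real.rpow_add ht, Real.rpow_mul ht.le, Real.rpow_natCast]
    rw [h1, integral_const_mul, hval, h2, mul_pow]
    have := (hGk k).ne'
    field_simp
  -- The integrals of the norms form a Mittag-Leffler type series at `|λ| t^ρ`, which justifies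
  -- exchanging sum and integral.
  have hsum : Summable fun k => ∫ s in Ioc 0 t, ‖F k s‖ := by
    simp_rw [hnorm]
    exact (summable_pow_div_Gamma hρ hρ1 _).mul_left _
  have key := (hasSum_integral_of_summable_integral_norm hint hsum).mul_left (1 / Real.Gamma α)
  rw [rlIntegral_of_pos hα, smul_eq_mul, intervalIntegral.integral_of_le ht.le]
  have hcongr : ∫ s in Ioc 0 t, ∑' k, F k s =
      ∫ s in Ioc 0 t, (t - s) ^ (α - 1) • scalarSol ρ lam s := by
    refine setIntegral_congr_fun measurableSet_Ioc fun s hs => ?_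
    refine HasSum.tsum_eq ?_
    refine ((hasSum_scalarSol (lam := lam) hρ hρ1 hs.1).mul_left ((t - s) ^ (α - 1))).congr_fun ?_
    intro k
    simp only [hF]
    rw [add_sub_assoc]
    ring
  rw [hcongr] at key
  refine key.congr_fun fun k => ?_
  simp only [hF]
  rw [integral_const_mul, hval]
  have := (hGk k).ne'
  field_simp

/-- The scalar problem in integrated form. -/
theorem rlIntegral_scalarSol {ρ lam t : ℝ} (hρ : 0 < ρ) (hρ1 : ρ ≤ 1) (ht : 0 < t) :
    rlIntegral (1 - ρ) (scalarSol ρ lam) t = 1 - lam * ∫ s in (0 : ℝ)..t, scalarSol ρ lam s := by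
  have h1 := hasSum_rlIntegral_scalarSol (lam := lam) hρ hρ1 (sub_nonneg.2 hρ1) ht
  have h2 := hasSum_rlIntegral_scalarSol (lam := lam) hρ hρ1 zero_le_one ht
  have h3 : rlIntegral 1 (scalarSol ρ lam) t = ∫ s in (0 : ℝ)..t, scalarSol ρ lam s := by
    rw [rlIntegral_of_pos one_pos]
    simp
  rw [h3] at h2
  -- The zeroth term of the order `1 - ρ` series is `t^0 / Γ(1) = 1`; the remaining terms are `-λ`
  -- times those of the ordinary integral.
  rw [← hasSum_nat_add_iff' 1] at h1
  have h4 := h1.unique ((h2.mul_left (-lam)).congr_fun fun k => ?_)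
  · simp at h4
    linarith
  · push_cast
    rw [show ρ * (k + 1 : ℝ) + (ρ + (1 - ρ) - 1) = ρ * k + (ρ + 1 - 1) by ring,
      show ρ * (k + 1 : ℝ) + (ρ + (1 - ρ)) = ρ * k + (ρ + 1) by ring]
    ring

/-! ### Regularity of the scalar solution and bounds uniform in the eigenvalue -/

theorem continuous_ml {ρ : ℝ} (hρ : 0 < ρ) (hρ1 : ρ ≤ 1) : Continuous (ml ρ) := by
  rw [continuous_iff_continuousAt]
  intro μ
  have h : ContinuousOn (ml ρ) (Metric.ball 0 (|μ| + 1)) := by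
    refine continuousOn_tsum (u := fun k : ℕ => (|μ| + 1) ^ k / Real.Gamma (ρ * k + ρ))
      (fun k => by fun_prop) (summable_pow_div_Gamma hρ hρ1 _) fun k x hx => ?_
    have hG : 0 < Real.Gamma (ρ * k + ρ) := Real.Gamma_pos_of_pos (by positivity)
    rw [norm_div, norm_pow, norm_neg, Real.norm_of_nonneg hG.le]
    have : ‖x‖ ≤ |μ| + 1 := (mem_ball_zero_iff.1 hx).le
    gcongr
  exact h.continuousAt (Metric.isOpen_ball.mem_nhds (by simp))

theorem continuousAt_scalarSol {ρ lam t : ℝ} (hρ : 0 < ρ) (hρ1 : ρ ≤ 1) (ht : 0 < t) :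
    ContinuousAt (scalarSol ρ lam) t := by
  have h1 : ContinuousAt (fun t : ℝ => t ^ (ρ - 1)) t :=
    Real.continuousAt_rpow_const _ _ (Or.inl ht.ne')
  have h2 : ContinuousAt (fun t : ℝ => t ^ ρ) t :=
    Real.continuousAt_rpow_const _ _ (Or.inl ht.ne')
  exact h1.mul ((continuous_ml hρ hρ1).continuousAt.comp (f := fun t : ℝ => lam * t ^ ρ)
    (h2.const_mul lam))

theorem continuousOn_scalarSol {ρ lam : ℝ} (hρ : 0 < ρ) (hρ1 : ρ ≤ 1) :
    ContinuousOn (scalarSol ρ lam) (Ioi 0) := fun _ ht =>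
  (continuousAt_scalarSol hρ hρ1 ht).continuousWithinAt

/-- The constant is independent of `λ`. The first bound gives convergence of the expansion and
integrability at `0`; the second puts the solution in the domain of the operator for every `φ`, with
no smoothness assumed. -/
theorem exists_scalarSol_bounds {ρ : ℝ} (hρ : 0 < ρ) (hρ1 : ρ ≤ 1) :
    ∃ C : ℝ, 0 ≤ C ∧ ∀ lam t : ℝ, 0 < lam → 0 < t →
      |scalarSol ρ lam t| ≤ C * t ^ (ρ - 1) ∧ |lam * scalarSol ρ lam t| ≤ C / t := by
  obtain ⟨C₁, h₁⟩ := exists_abs_ml_le hρ hρ1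
  obtain ⟨C₂, h₂⟩ := exists_mul_abs_ml_le hρ hρ1
  refine ⟨max 0 (max C₁ C₂), le_max_left _ _, fun lam t hlam ht => ?_⟩
  have hμ : 0 < lam * t ^ ρ := by positivity
  have b1 := (h₁ _ hμ).trans ((le_max_left C₁ C₂).trans (le_max_right 0 _))
  have b2 := (h₂ _ hμ).trans ((le_max_right C₁ C₂).trans (le_max_right 0 _))
  constructor
  · rw [scalarSol, abs_mul, abs_of_pos (Real.rpow_pos_of_pos ht _), mul_comm]
    gcongr
  · rw [scalarSol, abs_mul, abs_mul, abs_of_pos (Real.rpow_pos_of_pos ht _), abs_of_pos hlam,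
      le_div_iff₀ ht, Real.rpow_sub_one ht.ne']
    refine le_trans (le_of_eq ?_) b2
    field_simp

theorem intervalIntegrable_scalarSol {ρ lam t : ℝ} (hρ : 0 < ρ) (hρ1 : ρ ≤ 1) (hlam : 0 < lam)
    (ht : 0 < t) : IntervalIntegrable (scalarSol ρ lam) volume 0 t := by
  obtain ⟨C, _, hC⟩ := exists_scalarSol_bounds hρ hρ1
  have h1 : IntervalIntegrable (fun s : ℝ => C * s ^ (ρ - 1)) volume 0 t :=
    (intervalIntegral.intervalIntegrable_rpow' (by linarith)).const_mul C
  rw [intervalIntegrable_iff_integrableOn_Ioc_of_le ht.le] at h1 ⊢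
  refine h1.mono' (((continuousOn_scalarSol hρ hρ1).mono Ioc_subset_Ioi_self).aestronglyMeasurable
    measurableSet_Ioc) ?_
  filter_upwards [ae_restrict_mem measurableSet_Ioc] with s hs
  exact (hC lam s hlam hs.1).1

/-- Fractional integration of order `1 - ρ` turns the bound `t^(ρ-1)` into a constant, by the Beta
integral. Uniformity in `λ` lets the initial condition pass to the limit in the expansion. -/
theorem exists_rlIntegral_scalarSol_bound {ρ : ℝ} (hρ : 0 < ρ) (hρ1 : ρ ≤ 1) :
    ∃ C : ℝ, ∀ lam t : ℝ, 0 < lam → 0 < t → |rlIntegral (1 - ρ) (scalarSol ρ lam) t| ≤ C := by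
  obtain ⟨C, hC0, hC⟩ := exists_scalarSol_bounds hρ hρ1
  rcases hρ1.lt_or_eq with h | rfl
  · have hα : 0 < 1 - ρ := by linarith
    have hG := Real.Gamma_pos_of_pos hα
    refine ⟨1 / Real.Gamma (1 - ρ) * (C * (Real.Gamma (1 - ρ) * Real.Gamma ρ)),
      fun lam t hlam ht => ?_⟩
    rw [rlIntegral_of_pos hα, smul_eq_mul, abs_mul, abs_of_pos (by positivity)]
    refine mul_le_mul_of_nonneg_left ?_ (by positivity)
    have hb := integral_sub_rpow_mul_rpow hα hρ ht
    simp only [sub_add_cancel, sub_self, Real.rpow_zero, Real.Gamma_one, one_mul, div_one] at hb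
    rw [← hb, ← intervalIntegral.integral_const_mul, ← Real.norm_eq_abs]
    refine intervalIntegral.norm_integral_le_of_norm_le ht.le (Eventually.of_forall fun s hs => ?_)
      ((intervalIntegrable_sub_rpow_mul_rpow hα hρ ht).const_mul C)
    have h1 := (hC lam s hlam hs.1).1
    have h2 : 0 ≤ t - s := sub_nonneg.2 hs.2
    rw [smul_eq_mul, norm_mul, Real.norm_of_nonneg (by positivity), Real.norm_eq_abs]
    calc _ ≤ (t - s) ^ (1 - ρ - 1) * (C * s ^ (ρ - 1)) := by gcongr
      _ = _ := by ring
  · refine ⟨C, fun lam t hlam ht => ?_⟩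
    rw [sub_self, rlIntegral_zero]
    simpa using (hC lam t hlam ht).1

theorem tendsto_rlIntegral_scalarSol {ρ lam : ℝ} (hρ : 0 < ρ) (hρ1 : ρ ≤ 1) (hlam : 0 < lam) :
    Tendsto (rlIntegral (1 - ρ) (scalarSol ρ lam)) (𝓝[>] 0) (𝓝 1) := by
  have h1 : ContinuousWithinAt (fun t => ∫ s in (0 : ℝ)..t, scalarSol ρ lam s) (Icc 0 1) 0 := by
    have := intervalIntegral.continuousOn_primitive_interval' (a := 0)
      (intervalIntegrable_scalarSol hρ hρ1 hlam one_pos) left_mem_uIcc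
    rw [uIcc_of_le zero_le_one] at this
    exact this 0 (by simp)
  have h2 : Tendsto (fun t => ∫ s in (0 : ℝ)..t, scalarSol ρ lam s) (𝓝[>] 0) (𝓝 0) := by
    have h3 : 𝓝[>] (0 : ℝ) ≤ 𝓝[Icc 0 1] 0 := by
      rw [← nhdsWithin_Ioc_eq_nhdsGT one_pos]
      exact nhdsWithin_mono _ Ioc_subset_Icc_self
    simpa using h1.tendsto.mono_left h3
  have h3 : Tendsto (fun t => 1 - lam * ∫ s in (0 : ℝ)..t, scalarSol ρ lam s) (𝓝[>] 0) (𝓝 1) := by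
    simpa using (h2.const_mul lam).const_sub 1
  refine h3.congr' ?_
  filter_upwards [self_mem_nhdsWithin] with t ht
  exact (rlIntegral_scalarSol hρ hρ1 ht).symm

theorem mul_integral_scalarSol {ρ lam s t : ℝ} (hρ : 0 < ρ) (hρ1 : ρ ≤ 1) (hlam : 0 < lam)
    (hs : 0 < s) (ht : 0 < t) :
    lam * ∫ r in s..t, scalarSol ρ lam r = rlIntegral (1 - ρ) (scalarSol ρ lam) s -
      rlIntegral (1 - ρ) (scalarSol ρ lam) t := by
  rw [rlIntegral_scalarSol hρ hρ1 hs, rlIntegral_scalarSol hρ hρ1 ht,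
    ← intervalIntegral.integral_interval_sub_left (intervalIntegrable_scalarSol hρ hρ1 hlam ht)
      (intervalIntegrable_scalarSol hρ hρ1 hlam hs)]
  ring

theorem scalarSol_one (lam t : ℝ) : scalarSol 1 lam t = Real.exp (-(lam * t)) := by
  rw [scalarSol, ml_one, sub_self, Real.rpow_zero, Real.rpow_one, one_mul]

/-! ### Uniqueness for the scalar fractional equation -/

section Uniqueness

variable {E : Type*} [NormedAddCommGroup E] [NormedSpace ℝ E]

theorem rlIntegral_congr {α t : ℝ} {f g : ℝ → E} (ht : 0 < t) (h : EqOn f g (Ioc 0 t)) :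
    rlIntegral α f t = rlIntegral α g t := by
  unfold rlIntegral
  split_ifs
  · exact h ⟨ht, le_rfl⟩
  · congr 1
    rw [intervalIntegral.integral_of_le ht.le, intervalIntegral.integral_of_le ht.le]
    exact setIntegral_congr_fun measurableSet_Ioc fun s hs => by simp only [h hs]

theorem integral_sub_rpow_mul_sub_rpow {ρ r t : ℝ} (hρ : 0 < ρ) (hρ1 : ρ < 1) (hrt : r < t) :
    IntervalIntegrable (fun s => (t - s) ^ (ρ - 1) * (s - r) ^ (1 - ρ - 1)) volume r t ∧
    ∫ s in r..t, (t - s) ^ (ρ - 1) * (s - r) ^ (1 - ρ - 1) =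
      Real.Gamma ρ * Real.Gamma (1 - ρ) := by
  have hα : 0 < 1 - ρ := by linarith
  have htr : 0 < t - r := by linarith
  have h1 := (intervalIntegrable_sub_rpow_mul_rpow hρ hα htr).comp_sub_right r
  have h2 := integral_sub_rpow_mul_rpow hρ hα htr
  have h3 := intervalIntegral.integral_comp_sub_right (a := r) (b := t)
    (fun s => (t - r - s) ^ (ρ - 1) * s ^ (1 - ρ - 1)) r
  simp only [sub_sub_sub_cancel_right, sub_self, zero_add, sub_add_cancel] at h1 h3
  refine ⟨h1, ?_⟩
  rw [h3, h2]
  simp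

/-- The composition of the fractional integrals of orders `ρ` and `1 - ρ` is the integral. -/
theorem rlIntegral_rlIntegral [CompleteSpace E] {ρ t : ℝ} {y : ℝ → E} (hρ : 0 < ρ) (hρ1 : ρ < 1) (ht : 0 < t)
    (hy : IntervalIntegrable y volume 0 t) :
    rlIntegral ρ (rlIntegral (1 - ρ) y) t = ∫ r in (0 : ℝ)..t, y r := by
  have hα : 0 < 1 - ρ := by linarith
  have hG1 := Real.Gamma_pos_of_pos hρ
  have hG2 := Real.Gamma_pos_of_pos hα
  set μ := (volume : Measure ℝ).restrict (Ioc 0 t) with hμ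
  rw [intervalIntegrable_iff_integrableOn_Ioc_of_le ht.le] at hy
  have hy' : Integrable y μ := hy
  -- Abel's kernel is extended by zero from the triangle `r < s` to the square, so that Fubini
  -- applies; its integral in `s` is the constant `Γ(ρ) Γ(1-ρ)`.
  set k : ℝ → ℝ → ℝ := fun s r =>
    (Ioi r).indicator (fun s => (t - s) ^ (ρ - 1) * (s - r) ^ (1 - ρ - 1)) s with hk
  have hk' : ∀ s r, k s r =
      (Iio s).indicator (fun r => (t - s) ^ (ρ - 1) * (s - r) ^ (1 - ρ - 1)) r := fun s r => rfl
  have hkm : Measurable fun p : ℝ × ℝ => k p.1 p.2 := by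
    have : (fun p : ℝ × ℝ => k p.1 p.2) = {p : ℝ × ℝ | p.2 < p.1}.indicator
        (fun p => (t - p.1) ^ (ρ - 1) * (p.1 - p.2) ^ (1 - ρ - 1)) := rfl
    rw [this]
    refine Measurable.indicator (by fun_prop) (measurableSet_lt measurable_snd measurable_fst)
  have hk0 : ∀ s ∈ Ioc 0 t, ∀ r, 0 ≤ k s r := fun s hs r => by
    refine indicator_apply_nonneg fun h => ?_
    have h1 : 0 ≤ t - s := sub_nonneg.2 hs.2
    have h2 : 0 ≤ s - r := sub_nonneg.2 (le_of_lt h)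
    positivity
  have hset : ∀ r, 0 ≤ r → Ioc 0 t ∩ Ioi r = Ioc r t := fun r hr => by
    ext s
    simp only [mem_inter_iff, mem_Ioc, mem_Ioi]
    constructor
    · rintro ⟨⟨_, h2⟩, h3⟩
      exact ⟨h3, h2⟩
    · rintro ⟨h1, h2⟩
      exact ⟨⟨hr.trans_lt h1, h2⟩, h1⟩
  have hslice : ∀ r, 0 < r → r < t → Integrable (fun s => k s r) μ ∧
      ∫ s, k s r ∂μ = Real.Gamma ρ * Real.Gamma (1 - ρ) := fun r hr hrt => by
    obtain ⟨h1, h2⟩ := integral_sub_rpow_mul_sub_rpow hρ hρ1 hrt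
    constructor
    · rw [hμ]
      simp only [hk]
      rw [integrable_indicator_iff measurableSet_Ioi, IntegrableOn,
        Measure.restrict_restrict measurableSet_Ioi, inter_comm, hset r hr.le]
      rwa [intervalIntegrable_iff_integrableOn_Ioc_of_le hrt.le] at h1
    · rw [hμ]
      simp only [hk]
      rw [setIntegral_indicator measurableSet_Ioi, hset r hr.le, ← h2,
        intervalIntegral.integral_of_le hrt.le]
  have hae : ∀ᵐ r ∂μ, 0 < r ∧ r < t := by
    have h1 : ∀ᵐ r ∂μ, r ∈ Ioc 0 t := ae_restrict_mem measurableSet_Ioc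
    have h2 : ∀ᵐ r ∂μ, r ≠ t := ae_restrict_of_ae (Measure.ae_ne volume t)
    filter_upwards [h1, h2] with r h1 h2
    exact ⟨h1.1, lt_of_le_of_ne h1.2 h2⟩
  have hF : Integrable (fun p : ℝ × ℝ => k p.1 p.2 • y p.2) (μ.prod μ) := by
    have hm : AEStronglyMeasurable (fun p : ℝ × ℝ => k p.1 p.2 • y p.2) (μ.prod μ) :=
      hkm.aestronglyMeasurable.smul hy'.1.comp_snd
    rw [integrable_prod_iff' hm]
    constructor
    · filter_upwards [hae] with r hr
      exact (hslice r hr.1 hr.2).1.smul_const _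
    · refine (hy'.norm.const_mul (Real.Gamma ρ * Real.Gamma (1 - ρ))).congr ?_
      filter_upwards [hae] with r hr
      rw [← (hslice r hr.1 hr.2).2, ← integral_mul_const]
      refine setIntegral_congr_fun measurableSet_Ioc fun s hs => ?_
      rw [norm_smul, Real.norm_of_nonneg (hk0 s hs r)]
  have hswap := integral_integral_swap (μ := μ) (ν := μ) (f := fun s r => k s r • y r) hF
  have hL : ∫ s, ∫ r, k s r • y r ∂μ ∂μ = ∫ s in Ioc 0 t,
      (t - s) ^ (ρ - 1) • (Real.Gamma (1 - ρ) • rlIntegral (1 - ρ) y s) := by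
    refine setIntegral_congr_fun measurableSet_Ioc fun s hs => ?_
    have hset2 : Ioc 0 t ∩ Iio s = Ioo 0 s := by
      ext r
      simp only [mem_inter_iff, mem_Ioc, mem_Iio, mem_Ioo]
      constructor
      · rintro ⟨⟨h1, _⟩, h3⟩
        exact ⟨h1, h3⟩
      · rintro ⟨h1, h2⟩
        exact ⟨⟨h1, h2.le.trans hs.2⟩, h2⟩
    have h1 : (fun r => k s r • y r) = (Iio s).indicator
        (fun r => ((t - s) ^ (ρ - 1) * (s - r) ^ (1 - ρ - 1)) • y r) := by
      ext r
      rw [hk', indicator_smul_apply_left]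
    rw [h1, hμ, setIntegral_indicator measurableSet_Iio, hset2, rlIntegral_of_pos hα,
      smul_smul (Real.Gamma _), mul_one_div_cancel hG2.ne', one_smul, intervalIntegral.integral_of_le hs.1.le,
      integral_Ioc_eq_integral_Ioo, ← integral_smul]
    simp_rw [mul_smul]
  have hR : ∫ r, ∫ s, k s r • y r ∂μ ∂μ =
      (Real.Gamma ρ * Real.Gamma (1 - ρ)) • ∫ r in (0 : ℝ)..t, y r := by
    rw [intervalIntegral.integral_of_le ht.le, ← integral_smul]
    refine integral_congr_ae ?_
    filter_upwards [hae] with r hr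
    rw [integral_smul_const, (hslice r hr.1 hr.2).2]
  rw [hL, hR] at hswap
  have h3 : ∫ s in Ioc 0 t, (t - s) ^ (ρ - 1) • (Real.Gamma (1 - ρ) • rlIntegral (1 - ρ) y s) =
      Real.Gamma (1 - ρ) • ∫ s in (0 : ℝ)..t, (t - s) ^ (ρ - 1) • rlIntegral (1 - ρ) y s := by
    rw [intervalIntegral.integral_of_le ht.le, ← integral_smul]
    refine setIntegral_congr_fun measurableSet_Ioc fun s _ => ?_
    rw [smul_comm]
  rw [h3] at hswap
  rw [rlIntegral_of_pos hρ]
  have h4 : ∫ s in (0 : ℝ)..t, (t - s) ^ (ρ - 1) • rlIntegral (1 - ρ) y s =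
      Real.Gamma ρ • ∫ r in (0 : ℝ)..t, y r := by
    have h5 := congrArg (fun x => (Real.Gamma (1 - ρ))⁻¹ • x) hswap
    simp only [smul_smul] at h5
    rwa [inv_mul_cancel₀ hG2.ne', one_smul, mul_left_comm, inv_mul_cancel₀ hG2.ne', mul_one] at h5
  rw [h4, smul_smul, one_div, inv_mul_cancel₀ hG1.ne', one_smul]

/-- Reflecting `s` to `t - s` and extending the integral to the half-line gives a Gamma integral. In
the norm weighted by `exp (-σt)`, the fractional integral of order `ρ` thus has norm at most
`σ^(-ρ)`. -/
theorem integral_rpow_mul_exp_le {ρ σ t : ℝ} (hρ : 0 < ρ) (hσ : 0 < σ) (ht : 0 ≤ t) :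
    IntervalIntegrable (fun s => (t - s) ^ (ρ - 1) * Real.exp (σ * s)) volume 0 t ∧
    ∫ s in (0 : ℝ)..t, (t - s) ^ (ρ - 1) * Real.exp (σ * s) ≤
      Real.exp (σ * t) * ((1 / σ) ^ ρ * Real.Gamma ρ) := by
  set f : ℝ → ℝ := fun r => Real.exp (σ * t) * (r ^ (ρ - 1) * Real.exp (-(σ * r))) with hf
  have hint : IntegrableOn (fun r : ℝ => r ^ (ρ - 1) * Real.exp (-(σ * r))) (Ioi 0) := by
    have := integrableOn_rpow_mul_exp_neg_mul_rpow (s := ρ - 1) (p := 1) (by linarith) one_pos hσ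
    simpa using this
  have hfi : IntervalIntegrable f volume 0 t := by
    rw [intervalIntegrable_iff_integrableOn_Ioc_of_le ht]
    exact (hint.mono_set Ioc_subset_Ioi_self).const_mul _
  have heq : ∀ s, f (t - s) = (t - s) ^ (ρ - 1) * Real.exp (σ * s) := fun s => by
    simp only [hf]
    rw [mul_left_comm, ← Real.exp_add]
    congr 2
    ring
  constructor
  · have := (hfi.comp_sub_left t).symm
    simpa [heq] using this
  · have h1 := intervalIntegral.integral_comp_sub_left (a := 0) (b := t) f t
    simp only [heq, sub_self, sub_zero] at h1
    rw [h1, hf, intervalIntegral.integral_const_mul, intervalIntegral.integral_of_le ht,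
      ← Real.integral_rpow_mul_exp_neg_mul_Ioi hρ hσ]
    refine mul_le_mul_of_nonneg_left ?_ (Real.exp_pos _).le
    refine setIntegral_mono_set hint ?_ Ioc_subset_Ioi_self.eventuallyLE
    filter_upwards [ae_restrict_mem measurableSet_Ioi] with r hr
    have : (0 : ℝ) < r := hr
    simp only [Pi.zero_apply]
    positivity

/-- A continuous solution of the homogeneous Abel equation `Y = -λ I^ρ Y` vanishes. -/
theorem eq_zero_of_eq_neg_smul_rlIntegral {ρ lam T : ℝ} {Y : ℝ → E} (hρ : 0 < ρ)
    (hT : 0 ≤ T) (hY : ContinuousOn Y (Icc 0 T)) (h0 : Y 0 = 0)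
    (h : ∀ t ∈ Ioc 0 T, Y t = -lam • rlIntegral ρ Y t) : ∀ t ∈ Icc 0 T, Y t = 0 := by
  have hG := Real.Gamma_pos_of_pos hρ
  have hlim : Tendsto (fun σ : ℝ => |lam| * (1 / σ) ^ ρ) atTop (𝓝 0) := by
    have := (tendsto_rpow_neg_atTop hρ).const_mul |lam|
    rw [mul_zero] at this
    refine this.congr' ?_
    filter_upwards [eventually_gt_atTop 0] with σ hσ
    rw [one_div, Real.inv_rpow hσ.le, Real.rpow_neg hσ.le]
  -- For `σ` this large the right-hand side is a contraction with factor `1/2` in the weighted norm,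
  -- so the weighted maximum satisfies `M ≤ M/2`.
  obtain ⟨σ, hσ, hσ2⟩ := ((eventually_gt_atTop 0).and
    (hlim.eventually_le_const (by norm_num : (0 : ℝ) < 1 / 2))).exists
  obtain ⟨τ, hτ, hmax⟩ := isCompact_Icc.exists_isMaxOn (nonempty_Icc.2 hT)
    (f := fun t => Real.exp (-(σ * t)) * ‖Y t‖) (by fun_prop)
  set M := Real.exp (-(σ * τ)) * ‖Y τ‖ with hM
  have hYle : ∀ s ∈ Icc 0 T, ‖Y s‖ ≤ M * Real.exp (σ * s) := fun s hs => by
    have h1 : Real.exp (-(σ * s)) * ‖Y s‖ ≤ M := hmax hs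
    have h2 : ‖Y s‖ = Real.exp (-(σ * s)) * ‖Y s‖ * Real.exp (σ * s) := by
      rw [mul_right_comm, ← Real.exp_add]; simp
    rw [h2]
    gcongr
  have hM0 : 0 ≤ M := by positivity
  have hMzero : M ≤ 0 := by
    rcases hτ.1.eq_or_lt with h1 | h1
    · rw [hM, ← h1, h0]; simp
    · obtain ⟨hi, hle⟩ := integral_rpow_mul_exp_le hρ hσ hτ.1
      have h2 : ‖∫ s in (0 : ℝ)..τ, (τ - s) ^ (ρ - 1) • Y s‖ ≤
          M * (Real.exp (σ * τ) * ((1 / σ) ^ ρ * Real.Gamma ρ)) := by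
        refine (intervalIntegral.norm_integral_le_of_norm_le hτ.1
          (Eventually.of_forall fun s hs => ?_) (hi.const_mul M)).trans ?_
        · have h3 := hYle s ⟨hs.1.le, hs.2.trans hτ.2⟩
          have h4 : 0 ≤ τ - s := sub_nonneg.2 hs.2
          rw [norm_smul, Real.norm_of_nonneg (by positivity)]
          calc _ ≤ (τ - s) ^ (ρ - 1) * (M * Real.exp (σ * s)) := by gcongr
            _ = _ := by ring
        · rw [intervalIntegral.integral_const_mul]
          gcongr
      have h5 : ‖Y τ‖ ≤ |lam| * (1 / σ) ^ ρ * (M * Real.exp (σ * τ)) := by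
        rw [h τ ⟨h1, hτ.2⟩, rlIntegral_of_pos hρ, norm_smul, norm_smul, norm_neg, Real.norm_eq_abs,
          Real.norm_of_nonneg (by positivity)]
        calc |lam| * (1 / Real.Gamma ρ * ‖∫ s in (0 : ℝ)..τ, (τ - s) ^ (ρ - 1) • Y s‖)
            ≤ |lam| * (1 / Real.Gamma ρ *
              (M * (Real.exp (σ * τ) * ((1 / σ) ^ ρ * Real.Gamma ρ)))) := by gcongr
          _ = _ := by field_simp
      have h6 : ‖Y τ‖ ≤ 1 / 2 * (M * Real.exp (σ * τ)) := h5.trans (by gcongr)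
      have h7 : M ≤ Real.exp (-(σ * τ)) * (1 / 2 * (M * Real.exp (σ * τ))) := by
        conv_lhs => rw [hM]
        gcongr
      have h8 : Real.exp (-(σ * τ)) * (1 / 2 * (M * Real.exp (σ * τ))) = M / 2 := by
        have : Real.exp (-(σ * τ)) * Real.exp (σ * τ) = 1 := by rw [← Real.exp_add]; simp
        linear_combination (1 / 2 * M) * this
      linarith
  intro t ht
  have h1 := hYle t ht
  rw [le_antisymm hMzero hM0, zero_mul] at h1
  exact norm_le_zero_iff.1 h1

/-- Multiplying by the bounded weight `(T - ξ)^ρ` cancels the kernel `(T - ξ)^(-ρ)`. -/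
theorem intervalIntegrable_of_rlIntegrable {ρ T : ℝ} {y : ℝ → E} (hρ : 0 < ρ) (hρ1 : ρ < 1)
    (hT : 0 < T) (h : RLIntegrable (1 - ρ) y T) : IntervalIntegrable y volume 0 T := by
  have h1 : IntervalIntegrable (fun ξ => (T - ξ) ^ (1 - ρ - 1) • y ξ) volume 0 T :=
    h.resolve_left (by linarith)
  rw [intervalIntegrable_iff_integrableOn_Ioo_of_le hT.le] at h1 ⊢
  have h2 : IntegrableOn (fun ξ => (T - ξ) ^ ρ • (T - ξ) ^ (1 - ρ - 1) • y ξ) (Ioo 0 T) := by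
    refine Integrable.bdd_smul h1 (T ^ ρ)
      (by fun_prop : Measurable fun ξ : ℝ => (T - ξ) ^ ρ).aestronglyMeasurable ?_
    filter_upwards [ae_restrict_mem measurableSet_Ioo] with ξ hξ
    have h3 : 0 ≤ T - ξ := sub_nonneg.2 hξ.2.le
    rw [Real.norm_of_nonneg (by positivity)]
    exact Real.rpow_le_rpow h3 (by linarith [hξ.1]) hρ.le
  refine h2.congr_fun (fun ξ hξ => ?_) measurableSet_Ioo
  have h3 : 0 < T - ξ := sub_pos.2 hξ.2
  simp only
  rw [smul_smul, ← Real.rpow_add h3]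
  simp

/-- The scalar homogeneous problem with zero initial value has only the trivial solution. -/
theorem eq_zero_of_hasRLDerivOn [CompleteSpace E] {ρ lam T : ℝ} {y : ℝ → E} (hρ : 0 < ρ) (hρ1 : ρ ≤ 1)
    (hlam : lam ≠ 0) (h : HasRLDerivOn ρ T y fun t => -lam • y t)
    (h0 : Tendsto (rlIntegral (1 - ρ) y) (𝓝[>] 0) (𝓝 0)) : ∀ t ∈ Ioc 0 T, y t = 0 := by
  intro t₁ ht₁
  have hT : 0 < T := ht₁.1.trans_le ht₁.2
  set z := rlIntegral (1 - ρ) y with hz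
  have hder : ∀ t ∈ Ioc 0 T, HasDerivWithinAt z (-lam • y t) (Ioc 0 T) t := fun t ht => (h t ht).2
  have hzc : ContinuousOn z (Ioc 0 T) := fun t ht => (hder t ht).continuousWithinAt
  have hzy : ρ = 1 → z = y := by
    rintro rfl
    ext t
    rw [hz, sub_self, rlIntegral_zero]
  have hy : IntervalIntegrable y volume 0 T := by
    rcases hρ1.lt_or_eq with h1 | h1
    · exact intervalIntegrable_of_rlIntegrable hρ h1 hT (h T ⟨hT, le_rfl⟩).1
    · rw [hzy h1] at hzc h0
      -- For `ρ = 1` the function `y` is its own fractional integral, hence continuous on `(0, T]`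
      -- with limit `0`; its value at `0` is arbitrary and is reset.
      have hc : ContinuousOn (Function.update y 0 0) (Icc 0 T) := by
        intro t ht
        rcases ht.1.eq_or_lt with h2 | h2
        · subst h2
          rw [continuousWithinAt_update_same]
          refine h0.mono_left (nhdsWithin_mono _ fun x hx => ?_)
          exact lt_of_le_of_ne hx.1.1 (Ne.symm hx.2)
        · have h3 := hzc t ⟨h2, ht.2⟩
          rw [continuousWithinAt_update_of_ne h2.ne']
          refine h3.mono_of_mem_nhdsWithin ?_
          filter_upwards [self_mem_nhdsWithin, mem_nhdsWithin_of_mem_nhds (Ioi_mem_nhds h2)]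
            with x hx hx2
          exact ⟨hx2, hx.2⟩
      refine (hc.intervalIntegrable_of_Icc hT.le).congr_ae ?_
      filter_upwards [ae_restrict_of_ae (Measure.ae_ne volume 0)] with x hx
      simp [Function.update_of_ne hx]
  set Y : ℝ → E := fun t => ∫ r in (0 : ℝ)..t, y r with hY
  have hYc : ContinuousOn Y (Icc 0 T) := by
    have := intervalIntegral.continuousOn_primitive_interval' hy left_mem_uIcc
    rwa [uIcc_of_le hT.le] at this
  -- The equation is integrated over `[s, t]` and `s → 0+`; the zero initial value removes the
  -- boundary term.
  have hzY : ∀ t ∈ Ioc 0 T, z t = -lam • Y t := by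
    intro t ht
    have hsub : ∀ s ∈ Ioo 0 t, z t - z s = -lam • (Y t - Y s) := by
      intro s hs
      have hyt : IntervalIntegrable y volume 0 t := hy.mono_set (by
        rw [uIcc_of_le ht.1.le, uIcc_of_le hT.le]; exact Icc_subset_Icc_right ht.2)
      have hys : IntervalIntegrable y volume 0 s := hyt.mono_set (by
        rw [uIcc_of_le ht.1.le, uIcc_of_le hs.1.le]; exact Icc_subset_Icc_right hs.2.le)
      have hyst : IntervalIntegrable y volume s t := hys.symm.trans hyt
      rw [hY]
      simp only
      rw [intervalIntegral.integral_interval_sub_left hyt hys, ← intervalIntegral.integral_smul]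
      refine (intervalIntegral.integral_eq_sub_of_hasDerivAt_of_le hs.2.le
        (hzc.mono fun x hx => ⟨hs.1.trans_le hx.1, hx.2.trans ht.2⟩) (fun x hx => ?_)
        (hyst.smul (-lam))).symm
      have hx1 : x ∈ Ioo 0 T := ⟨hs.1.trans hx.1, hx.2.trans_le ht.2⟩
      exact (hder x (Ioo_subset_Ioc_self hx1)).hasDerivAt (Ioc_mem_nhds hx1.1 hx1.2)
    have hY0 : Tendsto Y (𝓝[>] 0) (𝓝 0) := by
      have h1 := (hYc 0 ⟨le_rfl, hT.le⟩).tendsto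
      have h2 : 𝓝[>] (0 : ℝ) ≤ 𝓝[Icc 0 T] 0 := by
        rw [← nhdsWithin_Ioc_eq_nhdsGT hT]
        exact nhdsWithin_mono _ Ioc_subset_Icc_self
      simpa [hY] using h1.mono_left h2
    have hl := h0.const_sub (z t)
    have hr := (hY0.const_sub (Y t)).const_smul (-lam)
    have heq := tendsto_nhds_unique (hl.congr' (by
      filter_upwards [Ioo_mem_nhdsGT ht.1] with s hs using hsub s hs)) hr
    simpa using heq
  -- Applying the integral of order `ρ` to `z = -λ Y` turns the left side into `Y`, by the semigroup
  -- property, and yields Abel's equation.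
  have hYeq : ∀ t ∈ Ioc 0 T, Y t = -lam • rlIntegral ρ Y t := by
    intro t ht
    have hyt : IntervalIntegrable y volume 0 t := hy.mono_set (by
      rw [uIcc_of_le ht.1.le, uIcc_of_le hT.le]; exact Icc_subset_Icc_right ht.2)
    have h1 : rlIntegral ρ z t = Y t := by
      rcases hρ1.lt_or_eq with h2 | h2
      · exact rlIntegral_rlIntegral hρ h2 ht.1 hyt
      · rw [hzy h2, h2, rlIntegral_of_pos one_pos]
        simp [hY]
    rw [← h1, rlIntegral_congr ht.1 (g := fun t => -lam • Y t)
      (fun s hs => hzY s ⟨hs.1, hs.2.trans ht.2⟩), rlIntegral_of_pos hρ, rlIntegral_of_pos hρ,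
      smul_comm (-lam)]
    congr 1
    rw [← intervalIntegral.integral_smul]
    exact intervalIntegral.integral_congr fun s _ => smul_comm ((t - s) ^ (ρ - 1)) (-lam) (Y s)
  have hYzero := eq_zero_of_eq_neg_smul_rlIntegral hρ hT.le hYc (by simp [hY]) hYeq
  have hz0 : EqOn z (fun _ => 0) (Ioc 0 T) := fun t ht => by
    rw [hzY t ht, hYzero t (Ioc_subset_Icc_self ht), smul_zero]
  have hu : UniqueDiffWithinAt ℝ (Ioc 0 T) t₁ := uniqueDiffOn_Ioc 0 T t₁ ht₁
  have h1 := (hasDerivWithinAt_const t₁ (Ioc 0 T) (0 : E)).congr hz0 (hz0 ht₁)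
  have h2 := hu.eq_deriv _ (hder t₁ ht₁) h1
  exact (smul_eq_zero.1 h2).resolve_left (neg_ne_zero.2 hlam)

end Uniqueness

/-! ### Fractional integrals and continuous linear maps -/

section Linear

variable {E F : Type*} [NormedAddCommGroup E] [NormedSpace ℝ E]
  [NormedAddCommGroup F] [NormedSpace ℝ F]

theorem RLIntegrable.map {α t : ℝ} {f : ℝ → E} (L : E →L[ℝ] F) (h : RLIntegrable α f t) :
    RLIntegrable α (fun s => L (f s)) t := by
  refine h.imp id fun h => ?_
  have : (fun ξ => (t - ξ) ^ (α - 1) • L (f ξ)) = fun ξ => L ((t - ξ) ^ (α - 1) • f ξ) := by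
    ext ξ; rw [map_smul]
  rw [this]
  exact ⟨L.integrable_comp h.1, L.integrable_comp h.2⟩

theorem map_rlIntegral [CompleteSpace E] [CompleteSpace F] {α t : ℝ} {f : ℝ → E} (L : E →L[ℝ] F)
    (h : RLIntegrable α f t) : L (rlIntegral α f t) = rlIntegral α (fun s => L (f s)) t := by
  unfold rlIntegral
  split_ifs with hα
  · rfl
  · rw [map_smul, ← L.intervalIntegral_comp_comm (h.resolve_left hα)]
    simp_rw [map_smul]

theorem RLIntegrable.sub {α t : ℝ} {f g : ℝ → E} (hf : RLIntegrable α f t)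
    (hg : RLIntegrable α g t) : RLIntegrable α (fun s => f s - g s) t := by
  by_cases hα : α = 0
  · exact Or.inl hα
  · right
    simp_rw [smul_sub]
    exact (hf.resolve_left hα).sub (hg.resolve_left hα)

theorem rlIntegral_sub {α t : ℝ} {f g : ℝ → E} (hf : RLIntegrable α f t)
    (hg : RLIntegrable α g t) :
    rlIntegral α (fun s => f s - g s) t = rlIntegral α f t - rlIntegral α g t := by
  unfold rlIntegral
  split_ifs with hα
  · rfl
  · rw [← smul_sub, ← intervalIntegral.integral_sub (hf.resolve_left hα) (hg.resolve_left hα)]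
    simp_rw [smul_sub]

theorem rlIntegral_smul_const [CompleteSpace E] (α t : ℝ) (f : ℝ → ℝ) (c : E) :
    rlIntegral α (fun s => f s • c) t = rlIntegral α f t • c := by
  unfold rlIntegral
  split_ifs
  · rfl
  · simp_rw [smul_smul, smul_eq_mul]
    rw [intervalIntegral.integral_smul_const, smul_smul]

end Linear

/-! ### Diagonal operators -/

section Diagonal

variable {𝕜 : Type*} [RCLike 𝕜] {H : Type*} [NormedAddCommGroup H] [InnerProductSpace 𝕜 H]
  {ι : Type*}

/-- The vector with coefficients `a k * ⟨v k, φ⟩`. -/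
def diag (v : HilbertBasis ι 𝕜 H) (a : ι → ℝ) (φ : H) : H :=
  ∑' k, ((a k : 𝕜) * v.repr φ k) • v k

theorem hasSum_norm_repr_sq (v : HilbertBasis ι 𝕜 H) (x : H) :
    HasSum (fun k => ‖v.repr x k‖ ^ 2) (‖x‖ ^ 2) := by
  have h := (v.hasSum_inner_mul_inner x x).mapL RCLike.reCLM
  have h1 : RCLike.reCLM (inner 𝕜 x x) = ‖x‖ ^ 2 := by
    rw [RCLike.reCLM_apply, inner_self_eq_norm_sq]
  rw [h1] at h
  refine h.congr_fun fun k => ?_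
  rw [v.repr_apply_apply, RCLike.reCLM_apply, ← inner_conj_symm x (v k), RCLike.conj_mul]
  norm_cast

theorem memℓp_mul_repr (v : HilbertBasis ι 𝕜 H) {a : ι → ℝ} {C : ℝ} (ha : ∀ k, |a k| ≤ C)
    (φ : H) : Memℓp (fun k => (a k : 𝕜) * v.repr φ k) 2 := by
  refine memℓp_gen ?_
  have h := (hasSum_norm_repr_sq v φ).summable.mul_left (C ^ 2)
  refine h.of_nonneg_of_le (fun k => by positivity) fun k => ?_
  simp only [ENNReal.toReal_ofNat, Real.rpow_ofNat]
  rw [norm_mul, mul_pow, RCLike.norm_ofReal]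
  have := ha k
  gcongr

theorem hasSum_diag (v : HilbertBasis ι 𝕜 H) {a : ι → ℝ} {C : ℝ} (ha : ∀ k, |a k| ≤ C)
    (φ : H) : HasSum (fun k => ((a k : 𝕜) * v.repr φ k) • v k) (diag v a φ) :=
  (v.hasSum_repr_symm ⟨_, memℓp_mul_repr v ha φ⟩).summable.hasSum

theorem repr_diag (v : HilbertBasis ι 𝕜 H) {a : ι → ℝ} {C : ℝ} (ha : ∀ k, |a k| ≤ C)
    (φ : H) (k : ι) : v.repr (diag v a φ) k = (a k : 𝕜) * v.repr φ k := by
  have h := (v.hasSum_repr_symm ⟨_, memℓp_mul_repr v ha φ⟩).tsum_eq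
  have h2 : diag v a φ = v.repr.symm ⟨_, memℓp_mul_repr v ha φ⟩ := h
  rw [h2, LinearIsometryEquiv.apply_symm_apply]

theorem ext_repr (v : HilbertBasis ι 𝕜 H) {x y : H} (h : ∀ k, v.repr x k = v.repr y k) : x = y :=
  v.repr.injective (lp.ext (funext h))

theorem diag_one (v : HilbertBasis ι 𝕜 H) (φ : H) : diag v (fun _ => 1) φ = φ :=
  ext_repr v fun k => by
    rw [repr_diag v (C := 1) (by simp)]
    simp

theorem diag_sub (v : HilbertBasis ι 𝕜 H) {a b : ι → ℝ} {C D : ℝ} (ha : ∀ k, |a k| ≤ C)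
    (hb : ∀ k, |b k| ≤ D) (φ : H) :
    diag v a φ - diag v b φ = diag v (fun k => a k - b k) φ :=
  ext_repr v fun k => by
    rw [repr_diag v (C := C + D) fun k => (abs_sub _ _).trans (add_le_add (ha k) (hb k)), map_sub,
      lp.coeFn_sub, Pi.sub_apply, repr_diag v ha, repr_diag v hb]
    push_cast
    ring

theorem hasSum_norm_diag_sq (v : HilbertBasis ι 𝕜 H) {a : ι → ℝ} {C : ℝ} (ha : ∀ k, |a k| ≤ C)
    (φ : H) : HasSum (fun k => a k ^ 2 * ‖v.repr φ k‖ ^ 2) (‖diag v a φ‖ ^ 2) := by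
  refine (hasSum_norm_repr_sq v (diag v a φ)).congr_fun fun k => ?_
  rw [repr_diag v ha, norm_mul, mul_pow, RCLike.norm_ofReal, sq_abs]

theorem norm_diag_le (v : HilbertBasis ι 𝕜 H) {a : ι → ℝ} {C : ℝ} (hC : 0 ≤ C)
    (ha : ∀ k, |a k| ≤ C) (φ : H) : ‖diag v a φ‖ ≤ C * ‖φ‖ := by
  refine le_of_sq_le_sq ?_ (by positivity)
  rw [mul_pow]
  refine hasSum_le (fun k => ?_) (hasSum_norm_diag_sq v ha φ)
    ((hasSum_norm_repr_sq v φ).mul_left (C ^ 2))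
  refine mul_le_mul_of_nonneg_right ?_ (by positivity)
  rw [← sq_abs]
  have := ha k
  gcongr

/-- By Parseval the squared distance is a series dominated by `(2C)² ‖⟨v_k, φ⟩‖²`, so
coefficientwise convergence with a uniform bound suffices. -/
theorem tendsto_diag (v : HilbertBasis ι 𝕜 H) {X : Type*} {l : Filter X} {a : X → ι → ℝ}
    {b : ι → ℝ} {C : ℝ} (ha : ∀ᶠ x in l, ∀ k, |a x k| ≤ C) (hb : ∀ k, |b k| ≤ C)
    (hlim : ∀ k, Tendsto (fun x => a x k) l (𝓝 (b k))) (φ : H) :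
    Tendsto (fun x => diag v (a x) φ) l (𝓝 (diag v b φ)) := by
  have h1 : Tendsto (fun x => ∑' k, (a x k - b k) ^ 2 * ‖v.repr φ k‖ ^ 2) l
      (𝓝 (∑' _ : ι, (0 : ℝ))) := by
    refine tendsto_tsum_of_dominated_convergence
      (bound := fun k => (C + C) ^ 2 * ‖v.repr φ k‖ ^ 2)
      ((hasSum_norm_repr_sq v φ).summable.mul_left _) (fun k => ?_) ?_
    · have := (((hlim k).sub_const (b k)).pow 2).mul_const (‖v.repr φ k‖ ^ 2)
      simpa using this
    · filter_upwards [ha] with x hx k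
      rw [Real.norm_of_nonneg (by positivity)]
      refine mul_le_mul_of_nonneg_right ?_ (by positivity)
      rw [← sq_abs]
      have := (abs_sub (a x k) (b k)).trans (add_le_add (hx k) (hb k))
      gcongr
  rw [tsum_zero] at h1
  rw [tendsto_iff_norm_sub_tendsto_zero]
  have h2 := h1.sqrt
  rw [Real.sqrt_zero] at h2
  refine h2.congr' ?_
  filter_upwards [ha] with x hx
  rw [diag_sub v hx hb, (hasSum_norm_diag_sq v (C := C + C)
    (fun k => (abs_sub _ _).trans (add_le_add (hx k) (hb k))) φ).tsum_eq,
    Real.sqrt_sq (norm_nonneg _)]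

end Diagonal

/-! ### Self-adjoint operators with a complete system of eigenvectors -/

section Operator

variable {𝕜 : Type*} [RCLike 𝕜] {H : Type*} [NormedAddCommGroup H] [InnerProductSpace 𝕜 H]
  [CompleteSpace H] {ι : Type*} {A : H →ₗ.[𝕜] H} {v : HilbertBasis ι 𝕜 H} {lam : ι → ℝ}

/-- Symmetry: `⟨v_k, A x⟩ = ⟨A v_k, x⟩ = λ_k ⟨v_k, x⟩`. -/
theorem repr_of_mem_graph (hA : IsSelfAdjoint A) (hv : ∀ k, (v k, (lam k : 𝕜) • v k) ∈ A.graph)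
    {x y : H} (hxy : (x, y) ∈ A.graph) (k : ι) : v.repr y k = (lam k : 𝕜) * v.repr x k := by
  have h := LinearPMap.adjoint_isFormalAdjoint hA.dense_domain
  rw [LinearPMap.isSelfAdjoint_def.1 hA] at h
  obtain ⟨x', hx1, hx2⟩ := (LinearPMap.mem_graph_iff A).1 hxy
  obtain ⟨w, hw1, hw2⟩ := (LinearPMap.mem_graph_iff A).1 (hv k)
  have h2 := h w x'
  simp only at hx1 hx2 hw1 hw2
  rw [hx1, hx2, hw1, hw2, inner_smul_left, RCLike.conj_ofReal] at h2
  rw [v.repr_apply_apply, v.repr_apply_apply, h2]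

/-- A self-adjoint operator is closed; finite partial sums lie in the graph, and both components
converge. -/
theorem diag_mem_graph (hA : IsSelfAdjoint A) (hv : ∀ k, (v k, (lam k : 𝕜) • v k) ∈ A.graph)
    {a : ι → ℝ} {C D : ℝ} (ha : ∀ k, |a k| ≤ C) (hla : ∀ k, |lam k * a k| ≤ D) (φ : H) :
    (diag v a φ, diag v (fun k => lam k * a k) φ) ∈ A.graph := by
  have h1 := (hasSum_diag v ha φ).prodMk (hasSum_diag v hla φ)
  have hcl : IsClosed (A.graph : Set (H × H)) := hA.isClosed
  refine hcl.mem_of_tendsto h1 (Eventually.of_forall fun s => ?_)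
  refine A.graph.sum_mem fun k _ => ?_
  have h2 := A.graph.smul_mem ((a k : 𝕜) * v.repr φ k) (hv k)
  rw [Prod.smul_mk, smul_smul] at h2
  convert h2 using 3
  push_cast
  ring

end Operator

/-! ### The eigenfunction expansion -/

section Forward

variable {𝕜 : Type*} [RCLike 𝕜] {H : Type*} [NormedAddCommGroup H] [InnerProductSpace 𝕜 H]
  {ι : Type*} {A : H →ₗ.[𝕜] H}
  {v : HilbertBasis ι 𝕜 H} {lam : ι → ℝ} {φ : H} {ρ lam₁ : ℝ}

/-- The solution of the forward problem as an eigenfunction expansion. -/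
def forwardSol (v : HilbertBasis ι 𝕜 H) (lam : ι → ℝ) (φ : H) (ρ t : ℝ) : H :=
  diag v (fun k => scalarSol ρ (lam k) t) φ

/-- The image of `forwardSol` under the operator. -/
def forwardSolImage (v : HilbertBasis ι 𝕜 H) (lam : ι → ℝ) (φ : H) (ρ t : ℝ) : H :=
  diag v (fun k => lam k * scalarSol ρ (lam k) t) φ

theorem continuousAt_forwardSol (hlam : ∀ k, 0 < lam k) (hρ : 0 < ρ) (hρ1 : ρ ≤ 1) {t : ℝ}
    (ht : 0 < t) : ContinuousAt (forwardSol v lam φ ρ) t := by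
  obtain ⟨C, hC0, hC⟩ := exists_scalarSol_bounds hρ hρ1
  have hb : ∀ s, t / 2 < s → ∀ k, |scalarSol ρ (lam k) s| ≤ C * (t / 2) ^ (ρ - 1) := fun s hs k => by
    have h1 : s ^ (ρ - 1) ≤ (t / 2) ^ (ρ - 1) :=
      Real.rpow_le_rpow_of_nonpos (by linarith) hs.le (by linarith)
    exact (hC _ _ (hlam k) (by linarith)).1.trans (by gcongr)
  refine tendsto_diag v ?_ (hb t (by linarith)) (fun k => continuousAt_scalarSol hρ hρ1 ht) φ
  filter_upwards [Ioi_mem_nhds (show t / 2 < t by linarith)] with s hs using hb s hs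

theorem continuousAt_forwardSolImage (hlam : ∀ k, 0 < lam k) (hρ : 0 < ρ) (hρ1 : ρ ≤ 1) {t : ℝ}
    (ht : 0 < t) : ContinuousAt (forwardSolImage v lam φ ρ) t := by
  obtain ⟨C, hC0, hC⟩ := exists_scalarSol_bounds hρ hρ1
  have hb : ∀ s, t / 2 < s → ∀ k, |lam k * scalarSol ρ (lam k) s| ≤ C / (t / 2) := fun s hs k =>
    (hC _ _ (hlam k) (by linarith)).2.trans (by gcongr)
  refine tendsto_diag v ?_ (hb t (by linarith))
    (fun k => (continuousAt_scalarSol hρ hρ1 ht).const_mul (lam k)) φ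
  filter_upwards [Ioi_mem_nhds (show t / 2 < t by linarith)] with s hs using hb s hs

theorem intervalIntegrable_forwardSolImage (hlam : ∀ k, 0 < lam k) (hρ : 0 < ρ) (hρ1 : ρ ≤ 1)
    {s t : ℝ} (hs : 0 < s) (ht : 0 < t) :
    IntervalIntegrable (forwardSolImage v lam φ ρ) volume s t := by
  refine ContinuousOn.intervalIntegrable fun r hr => ?_
  have hr0 : 0 < r := (lt_min hs ht).trans_le hr.1
  exact (continuousAt_forwardSolImage hlam hρ hρ1 hr0).continuousWithinAt

theorem rlIntegrable_forwardSol [NormedSpace ℝ H] (hlam : ∀ k, 0 < lam k) (hρ : 0 < ρ) (hρ1 : ρ ≤ 1) {t : ℝ}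
    (ht : 0 < t) : RLIntegrable (1 - ρ) (forwardSol v lam φ ρ) t := by
  rcases hρ1.eq_or_lt with h | h
  · exact Or.inl (by linarith)
  right
  obtain ⟨C, hC0, hC⟩ := exists_scalarSol_bounds hρ hρ1
  have h1 := (intervalIntegrable_sub_rpow_mul_rpow (sub_pos.2 h) hρ ht).const_mul (C * ‖φ‖)
  rw [intervalIntegrable_iff_integrableOn_Ioc_of_le ht.le] at h1 ⊢
  have hc : ContinuousOn (forwardSol v lam φ ρ) (Ioc 0 t) := fun s hs =>
    (continuousAt_forwardSol hlam hρ hρ1 hs.1).continuousWithinAt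
  refine h1.mono' (AEStronglyMeasurable.smul
    (by fun_prop : Measurable fun s : ℝ => (t - s) ^ (1 - ρ - 1)).aestronglyMeasurable
    (hc.aestronglyMeasurable measurableSet_Ioc)) ?_
  filter_upwards [ae_restrict_mem measurableSet_Ioc] with s hs
  have h2 : 0 ≤ t - s := sub_nonneg.2 hs.2
  have hs0 := hs.1
  have h3 : ‖forwardSol v lam φ ρ s‖ ≤ C * s ^ (ρ - 1) * ‖φ‖ :=
    norm_diag_le v (by positivity) (fun k => (hC _ _ (hlam k) hs0).1) φ
  rw [norm_smul, Real.norm_of_nonneg (by positivity)]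
  calc _ ≤ (t - s) ^ (1 - ρ - 1) * (C * s ^ (ρ - 1) * ‖φ‖) := by gcongr
    _ = _ := by ring

/-! ### Dependence of the norm on the order -/

theorem strictAntiOn_norm_forwardSol_sq {ρ₀ t : ℝ} (hφ : φ ≠ 0) (hlam : ∀ k, 0 < lam k)
    (hρ₀ : 0 < ρ₀) (hρ₀1 : ρ₀ < 1) (ht : 0 < t)
    (hanti : ∀ k, StrictAntiOn (fun ρ => scalarSol ρ (lam k) t) (Icc ρ₀ 1)) :
    StrictAntiOn (fun ρ => ‖forwardSol v lam φ ρ t‖ ^ 2) (Icc ρ₀ 1) := by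
  intro a ha b hb hab
  obtain ⟨C, _, hC⟩ := exists_scalarSol_bounds (hρ₀.trans_le ha.1) ha.2
  obtain ⟨D, _, hD⟩ := exists_scalarSol_bounds (hρ₀.trans_le hb.1) hb.2
  have hlt : ∀ k, scalarSol b (lam k) t ^ 2 < scalarSol a (lam k) t ^ 2 := fun k => by
    have h1 := hanti k ha hb hab
    -- Positivity is inherited from order `1`, where the value is an exponential, because the values
    -- decrease in the order. It is what lets the comparison pass to squares.
    have h2 : 0 < scalarSol b (lam k) t := by
      have h3 := (hanti k).antitoneOn hb (right_mem_Icc.2 hρ₀1.le) hb.2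
      simp only [scalarSol_one] at h3
      exact (Real.exp_pos _).trans_le h3
    simp only at h1
    gcongr
  obtain ⟨k, hk⟩ : ∃ k, v.repr φ k ≠ 0 := by
    by_contra! h
    exact hφ (ext_repr v fun k => by rw [h k]; simp)
  refine hasSum_lt (i := k) (fun k => ?_) ?_
    (hasSum_norm_diag_sq v (fun k => (hD _ t (hlam k) ht).1) φ)
    (hasSum_norm_diag_sq v (fun k => (hC _ t (hlam k) ht).1) φ)
  · exact mul_le_mul_of_nonneg_right (hlt k).le (by positivity)
  · exact mul_lt_mul_of_pos_right (hlt k) (by positivity)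

theorem continuousOn_norm_forwardSol_sq {ρ₀ t : ℝ} (hlam : ∀ k, 0 < lam k)
    (hρ₀ : 0 < ρ₀) (hρ₀1 : ρ₀ < 1) (ht : 0 < t)
    (hanti : ∀ k, StrictAntiOn (fun ρ => scalarSol ρ (lam k) t) (Icc ρ₀ 1))
    (hcont : ∀ k, ContinuousOn (fun ρ => scalarSol ρ (lam k) t) (Icc ρ₀ 1)) :
    ContinuousOn (fun ρ => ‖forwardSol v lam φ ρ t‖ ^ 2) (Icc ρ₀ 1) := by
  obtain ⟨C, _, hC⟩ := exists_scalarSol_bounds hρ₀ hρ₀1.le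
  -- Monotonicity in the order places every coefficient between `0` and its value at `ρ₀`, giving a
  -- bound uniform in both `ρ` and `k`.
  have hb : ∀ ρ ∈ Icc ρ₀ 1, ∀ k, |scalarSol ρ (lam k) t| ≤ C * t ^ (ρ₀ - 1) := fun ρ hρ k => by
    have h1 := (hanti k).antitoneOn hρ (right_mem_Icc.2 hρ₀1.le) hρ.2
    have h2 := (hanti k).antitoneOn (left_mem_Icc.2 hρ₀1.le) hρ hρ.1
    simp only [scalarSol_one] at h1 h2
    rw [abs_of_nonneg ((Real.exp_pos _).le.trans h1)]
    exact h2.trans ((le_abs_self _).trans (hC _ t (hlam k) ht).1)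
  intro ρ hρ
  refine ContinuousWithinAt.pow (ContinuousWithinAt.norm ?_) 2
  refine tendsto_diag v ?_ (hb ρ hρ) (fun k => hcont k ρ hρ) φ
  filter_upwards [self_mem_nhdsWithin] with r hr using hb r hr

/-! ### The forward problem -/

variable [NormedSpace ℝ H] [IsScalarTower ℝ 𝕜 H]

/-- The `k`-th coefficient as a real-linear functional. -/
def coeffCLM (v : HilbertBasis ι 𝕜 H) (k : ι) : H →L[ℝ] 𝕜 := (innerSL 𝕜 (v k)).restrictScalars ℝ

theorem coeffCLM_apply (k : ι) (x : H) : coeffCLM v k x = v.repr x k := by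
  rw [v.repr_apply_apply]; rfl

variable [CompleteSpace H]

/-- Each coefficient of the difference of two solutions solves the scalar homogeneous problem with
zero initial value. -/
theorem isForwardSolution_unique (hA : IsSelfAdjoint A)
    (hv : ∀ k, (v k, (lam k : 𝕜) • v k) ∈ A.graph) (hlam : ∀ k, 0 < lam k) (hρ : 0 < ρ)
    (hρ1 : ρ ≤ 1) {T : ℝ} {u₁ u₂ : ℝ → H} (h₁ : IsForwardSolution A φ T ρ u₁)
    (h₂ : IsForwardSolution A φ T ρ u₂) : EqOn u₁ u₂ (Ioc 0 T) := by
  obtain ⟨D₁, Au₁, hD₁, hg₁, -, -, he₁, hl₁⟩ := h₁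
  obtain ⟨D₂, Au₂, hD₂, hg₂, -, -, he₂, hl₂⟩ := h₂
  intro t ht
  have hT : 0 < T := ht.1.trans_le ht.2
  refine ext_repr v fun k => ?_
  set L := coeffCLM v k with hL
  have hrl : EqOn (rlIntegral (1 - ρ) fun s => L (u₁ s - u₂ s))
      (fun s => L (rlIntegral (1 - ρ) u₁ s - rlIntegral (1 - ρ) u₂ s)) (Ioc 0 T) := fun s hs => by
    simp only
    rw [← rlIntegral_sub (hD₁ s hs).1 (hD₂ s hs).1,
      map_rlIntegral L ((hD₁ s hs).1.sub (hD₂ s hs).1)]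
  have hder : HasRLDerivOn ρ T (fun s => L (u₁ s - u₂ s)) fun s => -lam k • L (u₁ s - u₂ s) := by
    intro s hs
    refine ⟨((hD₁ s hs).1.sub (hD₂ s hs).1).map L, ?_⟩
    have h1 := L.hasFDerivAt.comp_hasDerivWithinAt s ((hD₁ s hs).2.sub (hD₂ s hs).2)
    refine (h1.congr hrl (hrl hs)).congr_deriv ?_
    simp only
    rw [eq_neg_of_add_eq_zero_left (he₁ s hs), eq_neg_of_add_eq_zero_left (he₂ s hs), map_sub,
      map_neg, map_neg, map_sub, hL, coeffCLM_apply, coeffCLM_apply, coeffCLM_apply, coeffCLM_apply,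
      repr_of_mem_graph hA hv (hg₁ s hs), repr_of_mem_graph hA hv (hg₂ s hs),
      RCLike.real_smul_eq_coe_mul]
    push_cast
    ring
  have hlim : Tendsto (rlIntegral (1 - ρ) fun s => L (u₁ s - u₂ s)) (𝓝[>] 0) (𝓝 0) := by
    have h1 := (L.continuous.tendsto (φ - φ)).comp (hl₁.sub hl₂)
    rw [sub_self, map_zero] at h1
    refine h1.congr' ?_
    filter_upwards [Ioc_mem_nhdsGT hT] with s hs using (hrl hs).symm
  have h := eq_zero_of_hasRLDerivOn hρ hρ1 (hlam k).ne' hder hlim t ht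
  rw [map_sub, hL, coeffCLM_apply, coeffCLM_apply] at h
  exact sub_eq_zero.1 h

theorem rlIntegral_forwardSol (hlam : ∀ k, 0 < lam k) (hρ : 0 < ρ) (hρ1 : ρ ≤ 1) {t : ℝ}
    (ht : 0 < t) : rlIntegral (1 - ρ) (forwardSol v lam φ ρ) t =
      diag v (fun k => rlIntegral (1 - ρ) (scalarSol ρ (lam k)) t) φ := by
  obtain ⟨C, hC0, hC⟩ := exists_scalarSol_bounds hρ hρ1
  obtain ⟨C', hC'⟩ := exists_rlIntegral_scalarSol_bound hρ hρ1
  refine ext_repr v fun k => ?_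
  rw [repr_diag v (fun k => hC' _ _ (hlam k) ht), ← coeffCLM_apply,
    map_rlIntegral _ (rlIntegrable_forwardSol hlam hρ hρ1 ht),
    rlIntegral_congr (g := fun s => scalarSol ρ (lam k) s • v.repr φ k) ht, rlIntegral_smul_const,
    RCLike.real_smul_eq_coe_mul]
  intro s hs
  simp only
  rw [coeffCLM_apply, forwardSol, repr_diag v (fun k => (hC _ _ (hlam k) hs.1).1),
    RCLike.real_smul_eq_coe_mul]

/-- The equation in integrated form, checked on each coefficient. The lower limit stays positive
because `A u` is controlled near `0` only by a multiple of `1/r`. The strong derivative then follows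
from the fundamental theorem of calculus. -/
theorem rlIntegral_forwardSol_sub (hlam : ∀ k, 0 < lam k) (hρ : 0 < ρ) (hρ1 : ρ ≤ 1) {s t : ℝ}
    (hs : 0 < s) (ht : 0 < t) :
    rlIntegral (1 - ρ) (forwardSol v lam φ ρ) t = rlIntegral (1 - ρ) (forwardSol v lam φ ρ) s -
      ∫ r in s..t, forwardSolImage v lam φ ρ r := by
  obtain ⟨C, hC0, hC⟩ := exists_scalarSol_bounds hρ hρ1
  obtain ⟨C', hC'⟩ := exists_rlIntegral_scalarSol_bound hρ hρ1
  refine ext_repr v fun k => ?_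
  rw [rlIntegral_forwardSol hlam hρ hρ1 ht, rlIntegral_forwardSol hlam hρ hρ1 hs, map_sub,
    lp.coeFn_sub, Pi.sub_apply, repr_diag v (fun k => hC' _ _ (hlam k) ht),
    repr_diag v (fun k => hC' _ _ (hlam k) hs), ← coeffCLM_apply (v := v) k (∫ r in s..t, _),
    ← (coeffCLM v k).intervalIntegral_comp_comm
      (intervalIntegrable_forwardSolImage hlam hρ hρ1 hs ht)]
  have h1 : ∫ r in s..t, coeffCLM v k (forwardSolImage v lam φ ρ r) =
      ∫ r in s..t, (lam k * scalarSol ρ (lam k) r) • v.repr φ k := by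
    refine intervalIntegral.integral_congr fun r hr => ?_
    have hr0 : 0 < r := (lt_min hs ht).trans_le hr.1
    simp only
    rw [coeffCLM_apply, forwardSolImage, repr_diag v (fun k => (hC _ _ (hlam k) hr0).2),
      RCLike.real_smul_eq_coe_mul]
  rw [h1, intervalIntegral.integral_smul_const, intervalIntegral.integral_const_mul,
    mul_integral_scalarSol hρ hρ1 (hlam k) hs ht, RCLike.real_smul_eq_coe_mul]
  push_cast
  ring

theorem hasDerivAt_rlIntegral_forwardSol (hlam : ∀ k, 0 < lam k) (hρ : 0 < ρ) (hρ1 : ρ ≤ 1) {t : ℝ}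
    (ht : 0 < t) : HasDerivAt (rlIntegral (1 - ρ) (forwardSol v lam φ ρ))
      (-forwardSolImage v lam φ ρ t) t := by
  have hs : 0 < t / 2 := half_pos ht
  have hcont : ContinuousOn (forwardSolImage v lam φ ρ) (Ioi 0) := fun r hr =>
    (continuousAt_forwardSolImage hlam hρ hρ1 hr).continuousWithinAt
  have h1 := intervalIntegral.integral_hasDerivAt_right
    (intervalIntegrable_forwardSolImage (v := v) (φ := φ) hlam hρ hρ1 hs ht)
    (hcont.stronglyMeasurableAtFilter isOpen_Ioi t ht)
    (continuousAt_forwardSolImage hlam hρ hρ1 ht)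
  refine (h1.const_sub (rlIntegral (1 - ρ) (forwardSol v lam φ ρ) (t / 2))).congr_of_eventuallyEq ?_
  filter_upwards [Ioi_mem_nhds ht] with r hr
  exact rlIntegral_forwardSol_sub hlam hρ hρ1 hs hr

theorem isForwardSolution_forwardSol (hA : IsSelfAdjoint A)
    (hv : ∀ k, (v k, (lam k : 𝕜) • v k) ∈ A.graph) (hlam : ∀ k, 0 < lam k) (hρ : 0 < ρ)
    (hρ1 : ρ ≤ 1) (T : ℝ) : IsForwardSolution A φ T ρ (forwardSol v lam φ ρ) := by
  obtain ⟨C, hC0, hC⟩ := exists_scalarSol_bounds hρ hρ1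
  obtain ⟨C', hC'⟩ := exists_rlIntegral_scalarSol_bound hρ hρ1
  have hcont : ContinuousOn (forwardSolImage v lam φ ρ) (Ioc 0 T) := fun r hr =>
    (continuousAt_forwardSolImage hlam hρ hρ1 hr.1).continuousWithinAt
  refine ⟨fun t => -forwardSolImage v lam φ ρ t, forwardSolImage v lam φ ρ, fun t ht =>
    ⟨rlIntegrable_forwardSol hlam hρ hρ1 ht.1,
      (hasDerivAt_rlIntegral_forwardSol hlam hρ hρ1 ht.1).hasDerivWithinAt⟩,
    fun t ht => diag_mem_graph hA hv (fun k => (hC _ _ (hlam k) ht.1).1)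
      (fun k => (hC _ _ (hlam k) ht.1).2) φ, hcont.neg, hcont, fun t _ => neg_add_cancel _, ?_⟩
  have h1 : Tendsto (fun t => diag v (fun k => rlIntegral (1 - ρ) (scalarSol ρ (lam k)) t) φ)
      (𝓝[>] 0) (𝓝 (diag v (fun _ => 1) φ)) := by
    refine tendsto_diag v (C := max 1 C') ?_ (fun k => by simp)
      (fun k => tendsto_rlIntegral_scalarSol hρ hρ1 (hlam k)) φ
    filter_upwards [self_mem_nhdsWithin] with t ht k
    exact (hC' _ _ (hlam k) ht).trans (le_max_right _ _)
  rw [diag_one] at h1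
  refine h1.congr' ?_
  filter_upwards [self_mem_nhdsWithin] with t ht
  exact (rlIntegral_forwardSol hlam hρ hρ1 ht).symm

theorem forwardWellPosed (hA : IsSelfAdjoint A)
    (hv : ∀ k, (v k, (lam k : 𝕜) • v k) ∈ A.graph) (hlam : ∀ k, 0 < lam k) (hρ : 0 < ρ)
    (hρ1 : ρ ≤ 1) (T : ℝ) : ForwardWellPosed A φ T ρ :=
  ⟨_, isForwardSolution_forwardSol hA hv hlam hρ hρ1 T, fun _ hu =>
    isForwardSolution_unique hA hv hlam hρ hρ1 hu
      (isForwardSolution_forwardSol hA hv hlam hρ hρ1 T)⟩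

/-- The solution chosen in the definition of `W` must agree with the expansion on `(0, T]`, by
uniqueness. -/
theorem W_eq (hA : IsSelfAdjoint A)
    (hv : ∀ k, (v k, (lam k : 𝕜) • v k) ∈ A.graph) (hlam : ∀ k, 0 < lam k) (hρ : 0 < ρ)
    (hρ1 : ρ ≤ 1) {t T : ℝ} (ht : t ∈ Ioc 0 T) :
    W A φ T t ρ = ‖forwardSol v lam φ ρ t‖ ^ 2 := by
  have h := isForwardSolution_forwardSol (φ := φ) hA hv hlam hρ hρ1 T
  have h2 := Classical.epsilon_spec (p := fun u : ℝ → H => IsForwardSolution A φ T ρ u) ⟨_, h⟩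
  rw [W, isForwardSolution_unique hA hv hlam hρ hρ1 h2 h ht]

end Forward

end Subdiffusion

end

/-! ### The inverse problem -/

theorem theorem2 (ρ₀ : ℝ) (hρ₀ : ρ₀ ∈ Set.Ioo (0 : ℝ) 1) (lam₁ : ℝ) (hlam₁ : 0 < lam₁) :
    ∃ T₀ : ℝ, 0 < T₀ ∧
      ∀ (𝕜 : Type*) [RCLike 𝕜]
        (H : Type*) [NormedAddCommGroup H] [InnerProductSpace 𝕜 H] [CompleteSpace H]
        [TopologicalSpace.SeparableSpace H] [NormedSpace ℝ H] [IsScalarTower ℝ 𝕜 H]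
        (A : H →ₗ.[𝕜] H) (_hA : IsSelfAdjoint A)
        (ι : Type*) (v : HilbertBasis ι 𝕜 H) (lam : ι → ℝ)
        (_hv : ∀ k, (v k, (lam k : 𝕜) • v k) ∈ A.graph)
        (_hleast : IsLeast (Set.range lam) lam₁)
        (φ : H) (_hφ : φ ≠ 0) (t₀ T : ℝ) (_ht₀ : T₀ ≤ t₀) (_hT : t₀ ≤ T),
        (∀ ρ ∈ Set.Icc ρ₀ 1, Subdiffusion.ForwardWellPosed A φ T ρ) ∧
        ∀ d₀ : ℝ,
          Subdiffusion.HasUniqueInverseSolution A φ T ρ₀ t₀ d₀ ↔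
            Subdiffusion.W A φ T t₀ 1 ≤ d₀ ∧ d₀ ≤ Subdiffusion.W A φ T t₀ ρ₀ := by
  obtain ⟨T₀, hT₀, hmono⟩ := Subdiffusion.exists_strictAntiOn_scalarSol hρ₀.1 hlam₁
  refine ⟨T₀, hT₀, ?_⟩
  intro 𝕜 _ H _ _ _ _ _ _ A hA ι v lam hv hleast φ hφ t₀ T ht₀ hT
  have hlam1 : ∀ k, lam₁ ≤ lam k := fun k => hleast.2 ⟨k, rfl⟩
  have hlam : ∀ k, 0 < lam k := fun k => hlam₁.trans_le (hlam1 k)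
  have ht0 : 0 < t₀ := hT₀.trans_le ht₀
  have ht : t₀ ∈ Set.Ioc 0 T := ⟨ht0, hT⟩
  have hpos : ∀ ρ ∈ Set.Icc ρ₀ 1, 0 < ρ := fun ρ hρ => hρ₀.1.trans_le hρ.1
  have hsol : ∀ ρ ∈ Set.Icc ρ₀ 1,
      Subdiffusion.IsForwardSolution A φ T ρ (Subdiffusion.forwardSol v lam φ ρ) := fun ρ hρ =>
    Subdiffusion.isForwardSolution_forwardSol hA hv hlam (hpos ρ hρ) hρ.2 T
  have huniq : ∀ ρ ∈ Set.Icc ρ₀ 1, ∀ u, Subdiffusion.IsForwardSolution A φ T ρ u →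
      Set.EqOn u (Subdiffusion.forwardSol v lam φ ρ) (Set.Ioc 0 T) := fun ρ hρ u hu =>
    Subdiffusion.isForwardSolution_unique hA hv hlam (hpos ρ hρ) hρ.2 hu (hsol ρ hρ)
  have hanti := Subdiffusion.strictAntiOn_norm_forwardSol_sq (v := v) hφ hlam hρ₀.1 hρ₀.2 ht0
    fun k => (hmono t₀ ht₀ _ (hlam1 k)).1
  have hcont := Subdiffusion.continuousOn_norm_forwardSol_sq (v := v) (φ := φ) hlam hρ₀.1 hρ₀.2 ht0
    (fun k => (hmono t₀ ht₀ _ (hlam1 k)).1) fun k => (hmono t₀ ht₀ _ (hlam1 k)).2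
  have hleft : ρ₀ ∈ Set.Icc ρ₀ 1 := Set.left_mem_Icc.2 hρ₀.2.le
  have hright : (1 : ℝ) ∈ Set.Icc ρ₀ 1 := Set.right_mem_Icc.2 hρ₀.2.le
  refine ⟨fun ρ hρ => Subdiffusion.forwardWellPosed hA hv hlam (hpos ρ hρ) hρ.2 T, fun d₀ => ?_⟩
  rw [Subdiffusion.W_eq hA hv hlam one_pos le_rfl ht,
    Subdiffusion.W_eq hA hv hlam hρ₀.1 hρ₀.2.le ht]
  constructor
  · rintro ⟨u, ρ, ⟨hρ, hu, rfl⟩, -⟩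
    rw [huniq ρ hρ u hu ht]
    exact ⟨hanti.antitoneOn hρ hright hρ.2, hanti.antitoneOn hleft hρ hρ.1⟩
  · rintro ⟨h1, h2⟩
    -- The value `d₀` is attained by continuity of the squared norm in the order; strict
    -- monotonicity then determines `ρ`, and forward uniqueness determines `u`.
    obtain ⟨ρ, hρ, hval⟩ := intermediate_value_Icc' hρ₀.2.le hcont ⟨h1, h2⟩
    refine ⟨_, ρ, ⟨hρ, hsol ρ hρ, hval⟩, ?_⟩
    rintro u' ρ' ⟨hρ', hu', hval'⟩
    rw [huniq ρ' hρ' u' hu' ht] at hval'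
    have heq : ρ' = ρ := hanti.injOn hρ' hρ (hval'.trans hval.symm)
    subst heq
    exact ⟨rfl, huniq ρ' hρ' u' hu'⟩
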